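/- Let $\mathsf X$ be a locally compact separable metric space with its Borel $\sigma$-field, and let $(\Omega,\mathcal F,(\mathcal F_t)_{t\ge 0},(X_t)_{t\ge 0},(\mathbb P_x)_{x\in\mathsf X})$ be a time-homogeneous strong Markov family on $\mathsf X$ with cad-lag paths and transition function $(P^t)_{t\ge0}$; the strong Markov property is understood at all optional times, i.e. at all stopping times of the filtration $(\mathcal F_{t+})_{t\ge0}$. A non-trivial $\sigma$-finite measure $\phi$ is an irreducibility measure if $\phi(A)>0$ implies $\mathbb E_x[\int_0^\infty \mathbf 1_A(X_s)\,ds]>0$ for all $x$; it is maximal if every irreducibility measure is absolutely continuous with respect to it. The process is $\psi$-irreducible if an irreducibility measure exists. A Borel set $A$ is accessible if $\psi(A)>0$, and full if $\psi(A^c)=0$, for some maximal irreducibility measure $\psi$. A Borel set $C$ is petite if there are a probability measure $a$ on $[0,\infty)$ and a non-trivial $\sigma$-finite measure $\nu$ such that $\int_0^\infty P^t(x,\cdot)\,a(dt)\ge\nu(\cdot)$ for all $x\in C$. Let $\Lambda_0$ be the class of measurable nondecreasing $r_0:[0,\infty)\to[2,\infty)$ such that $t\mapsto \log r_0(t)/t$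 is nonincreasing on $(0,\infty)$ with limit $0$ at infinity, and let $\Lambda$ (the subgeometric rates) be the class of measurable $r:[0,\infty)\to(0,\infty)$ such that $0<\liminf_{t\to\infty} r(t)/r_0(t)\le\limsup_{t\to\infty} r(t)/r_0(t)<\infty$ for some $r_0\in\Lambda_0$. For $\delta>0$ put $\tau_C(\delta)=\inf\{t\ge\delta: X_t\in C\}$ (with $\inf\emptyset=\infty$) and $G_C(x,f,r;\delta)=\mathbb E_x\big[\int_0^{\tau_C(\delta)} r(s)f(X_s)\,ds\big]$. A Borel set $C$ is $(f,r)$-regular if $\sup_{x\in C}G_B(x,f,r;\delta)<\infty$ for all $\delta>0$ and all accessible $B$. **Proposition.** Assume that the process is $\psi$-irreducible. Let $f:\mathsf X\to[1,\infty)$ be measurable and let $r\in\Lambda$ be bounded, and bounded away from $0$, on every compact interval $[0,T]$. The following are equivalent: (i) there exist a non-empty closed petite set $C$ and $\delta>0$ such that $\sup_{x\in C}G_C(x,f,r;\delta)<\infty$; (ii) there exists an accessible closed $(f,r)$-regular set; (iii) there exists a full set which is a countable union of $(f,r)$-regular sets. -/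

import Mathlib

open MeasureTheory ProbabilityTheory Filter Topology Set
open scoped NNReal ENNReal

/-- A path `[0, ∞) → E` is cad-lag: right-continuous with left limits in `E`. -/
def IsCadlag {E : Type*} [TopologicalSpace E] (p : ℝ≥0 → E) : Prop :=
  (∀ t, ContinuousWithinAt p (Ici t) t) ∧ ∀ t, 0 < t → ∃ l, Tendsto p (𝓝[<] t) (𝓝 l)

/-- A time-homogeneous strong Markov family with cad-lag paths on the state space `E`, realised on
the measurable space `Ω`, with transition function `trans` and laws `law x` (started at `x`). -/
structure StrongMarkovFamily (E Ω : Type*) [TopologicalSpace E] [MeasurableSpace E]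
    [mΩ : MeasurableSpace Ω] where
  /-- the filtration `(𝓕ₜ)` -/
  filtration : Filtration ℝ≥0 mΩ
  /-- the process `(Xₜ)` -/
  X : ℝ≥0 → Ω → E
  /-- the probability `ℙ_x` -/
  law : E → Measure Ω
  /-- the transition function `(Pᵗ)` -/
  trans : ℝ≥0 → Kernel E E
  isProbabilityMeasure_law : ∀ x, IsProbabilityMeasure (law x)
  adapted : Adapted filtration X
  cadlag : ∀ ω, IsCadlag fun t => X t ω
  initial : ∀ x, ∀ᵐ ω ∂law x, X 0 ω = x
  law_apply : ∀ t x A, MeasurableSet A → law x {ω | X t ω ∈ A} = trans t x A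
  /-- The strong Markov property at every optional time `τ` (every stopping time of the filtration
  `(𝓕ₜ₊)`): on `{τ < ∞}`, `ℙ_x(X_{τ+s} ∈ A | 𝓕_{τ+}) = Pˢ(X_τ, A)`, in integrated form. -/
  strong_markov : ∀ (x : E) (τ : Ω → WithTop ℝ≥0) (hτ : IsStoppingTime filtration.rightCont τ)
    (s : ℝ≥0) (A : Set E), MeasurableSet A → ∀ F : Set Ω, MeasurableSet[hτ.measurableSpace] F →
      law x {ω | ω ∈ F ∧ τ ω ≠ ⊤ ∧ X ((τ ω).untopD 0 + s) ω ∈ A} =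
        ∫⁻ ω in {ω | ω ∈ F ∧ τ ω ≠ ⊤}, trans s (X ((τ ω).untopD 0) ω) A ∂law x

/-- Lebesgue measure on the time axis `[0, ∞)`. -/
noncomputable def timeMeasure : Measure ℝ≥0 :=
  (volume : Measure ℝ).comap ((↑) : ℝ≥0 → ℝ)

namespace StrongMarkovFamily

variable {E Ω : Type*} [TopologicalSpace E] [MeasurableSpace E] [MeasurableSpace Ω]

/-- `φ` is an irreducibility measure: it is σ-finite, non-trivial, and `φ(A) > 0` implies
`𝔼_x[∫₀^∞ 1_A(X_s) ds] > 0` for all `x`. -/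
def IsIrreducibilityMeasure (M : StrongMarkovFamily E Ω) (φ : Measure E) : Prop :=
  SigmaFinite φ ∧ φ ≠ 0 ∧ ∀ A, MeasurableSet A → 0 < φ A → ∀ x,
    0 < ∫⁻ ω, ∫⁻ s, A.indicator (1 : E → ℝ≥0∞) (M.X s ω) ∂timeMeasure ∂M.law x

/-- The process is irreducible: it has an irreducibility measure. -/
def IsIrreducible (M : StrongMarkovFamily E Ω) : Prop :=
  ∃ φ, M.IsIrreducibilityMeasure φ

/-- `ψ` is a maximal irreducibility measure: it dominates every irreducibility measure. -/
def IsMaximalIrreducibilityMeasure (M : StrongMarkovFamily E Ω) (ψ : Measure E) : Prop :=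
  M.IsIrreducibilityMeasure ψ ∧ ∀ φ, M.IsIrreducibilityMeasure φ → φ ≪ ψ

/-- `A` is accessible: `ψ(A) > 0` for some maximal irreducibility measure `ψ`. -/
def IsAccessible (M : StrongMarkovFamily E Ω) (A : Set E) : Prop :=
  MeasurableSet A ∧ ∃ ψ, M.IsMaximalIrreducibilityMeasure ψ ∧ 0 < ψ A

/-- `A` is full: `ψ(Aᶜ) = 0` for some maximal irreducibility measure `ψ`. -/
def IsFull (M : StrongMarkovFamily E Ω) (A : Set E) : Prop :=
  MeasurableSet A ∧ ∃ ψ, M.IsMaximalIrreducibilityMeasure ψ ∧ ψ Aᶜ = 0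

/-- `C` is petite: `∫ Pᵗ(x, ·) a(dt) ≥ ν` for all `x ∈ C`, for some probability measure `a` on
`[0, ∞)` and some non-trivial σ-finite measure `ν`. -/
def IsPetite (M : StrongMarkovFamily E Ω) (C : Set E) : Prop :=
  MeasurableSet C ∧ ∃ (a : Measure ℝ≥0) (ν : Measure E),
    IsProbabilityMeasure a ∧ SigmaFinite ν ∧ ν ≠ 0 ∧
      ∀ x ∈ C, ∀ A, MeasurableSet A → ν A ≤ ∫⁻ t, M.trans t x A ∂a

/-- The delayed hitting time `τ_C(δ) = inf {t ≥ δ, X_t ∈ C}` (`⊤` if there is no such `t`). -/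
noncomputable def delayedHittingTime (M : StrongMarkovFamily E Ω) (C : Set E) (δ : ℝ≥0) :
    Ω → WithTop ℝ≥0 :=
  hittingAfter M.X C δ

/-- The `(f, r)`-modulated moment `G_C(x, f, r; δ) = 𝔼_x[∫₀^{τ_C(δ)} r(s) f(X_s) ds]`. -/
noncomputable def modulatedMoment (M : StrongMarkovFamily E Ω) (C : Set E) (x : E) (f : E → ℝ≥0)
    (r : ℝ≥0 → ℝ≥0) (δ : ℝ≥0) : ℝ≥0∞ :=
  ∫⁻ ω, ∫⁻ s in {s : ℝ≥0 | (s : WithTop ℝ≥0) < M.delayedHittingTime C δ ω},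
    ((r s * f (M.X s ω) : ℝ≥0) : ℝ≥0∞) ∂timeMeasure ∂M.law x

/-- `C` is `(f, r)`-regular: `sup_{x ∈ C} G_B(x, f, r; δ) < ∞` for all `δ > 0` and all
accessible `B`. -/
def IsRegular (M : StrongMarkovFamily E Ω) (f : E → ℝ≥0) (r : ℝ≥0 → ℝ≥0) (C : Set E) : Prop :=
  MeasurableSet C ∧ ∀ δ : ℝ≥0, 0 < δ → ∀ B, M.IsAccessible B →
    ⨆ x ∈ C, M.modulatedMoment B x f r δ < ⊤

end StrongMarkovFamily

/-- The class `Λ₀`: measurable nondecreasing `r : [0, ∞) → [2, ∞)` such that `log r(t) / t`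
decreases to `0` as `t → ∞`. -/
def IsSubgeometricRate₀ (r : ℝ≥0 → ℝ≥0) : Prop :=
  Measurable r ∧ Monotone r ∧ (∀ t, 2 ≤ r t) ∧
    AntitoneOn (fun t : ℝ≥0 => Real.log (r t) / t) (Ioi 0) ∧
    Tendsto (fun t : ℝ≥0 => Real.log (r t) / t) atTop (𝓝 0)

/-- The class `Λ` of subgeometric rate functions: positive measurable functions `r` such that
`0 < liminf r(t)/r₀(t) ≤ limsup r(t)/r₀(t) < ∞` for some `r₀ ∈ Λ₀`. -/
def IsSubgeometricRate (r : ℝ≥0 → ℝ≥0) : Prop :=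
  Measurable r ∧ (∀ t, 0 < r t) ∧ ∃ r₀, IsSubgeometricRate₀ r₀ ∧
    0 < liminf (fun t => ((r t / r₀ t : ℝ≥0) : ℝ≥0∞)) atTop ∧
    limsup (fun t => ((r t / r₀ t : ℝ≥0) : ℝ≥0∞)) atTop < ⊤

/-! The substance is the step from one closed petite set C with bounded return costs to a full union
of regular sets. The way back is soft: regularity passes to measurable subsets, a charged set
contains a closed charged set, and even a closed petite one
(`IsMaximalIrreducibilityMeasure.exists_isPetite`). Since r is bounded and bounded away from 0 on
compacts, it is comparable on all of [0, ∞) to a rate in Λ₀, which is nondecreasing and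
submultiplicative.

Let B be accessible. Petiteness gives a horizon L and γ > 0 such that, from every point of C, time
is spent in B between t and L with probability at least γ (`IsPetite.exists_occupation`). Return
bounds can be iterated (`ReturnBound.add`), so the return to C may be delayed beyond L. Let κ be the
supremum, over x in C and clocks s ≥ s₀, of the expected cost until B is occupied, divided by r(s).
Splitting at the delayed return T gives κ ≤ K + κ E[r(s+T)/r(s); B not occupied before L].
Subgeometricity turns this into a contraction: for large s, r(s+t) ≤ r(s)(1 + ε(1 + ∫₀ᵗ r)), and as
f ≥ 1 the integral is paid for by the return cost. With ε(1+K) = γ/2 the factor is at most 1 - γ/2.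
Truncating f makes κ finite a priori, and monotone convergence removes the truncation
(`ReturnBound.lintegral_costUntil_le`). From other states one adds the cost of first reaching C
(`exists_modulatedMoment_le`). Hence, off a null set, the sublevel sets of that cost are regular,
and they exhaust almost everything because reaching C after time u is part of a sufficiently delayed
return.

Two substitutions avoid hitting times of general Borel sets. For B, the first visit is replaced by
the moment when the occupation time becomes positive, which can only increase the cost. For closed
C, the hitting time is replaced by an optional time below it that almost surely lands in C
(`exists_isOptional_eval_mem_ae`). Optional times live on the cad-lag path space, where the strong
Markov property becomes an identity for the shifted path (`lintegral_shift`). -/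

/-! ### Right-continuous processes evaluated at random times -/

section RightContinuous

variable {E α : Type*} [TopologicalSpace E] [TopologicalSpace.PseudoMetrizableSpace E]
  [MeasurableSpace E] [BorelSpace E] [MeasurableSpace α]

theorem tendsto_natFloor_succ_div (s : ℝ≥0) :
    Tendsto (fun n : ℕ => ((⌊s * (n + 1)⌋₊ + 1 : ℕ) : ℝ≥0) / (n + 1)) atTop (𝓝 s) := by
  have h1 : Tendsto (fun n : ℕ => s + 1 / ((n : ℝ≥0) + 1)) atTop (𝓝 s) := by
    simpa using tendsto_const_nhds.add (tendsto_one_div_add_atTop_nhds_zero_nat (𝕜 := ℝ≥0))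
  refine tendsto_of_tendsto_of_tendsto_of_le_of_le tendsto_const_nhds h1 (fun n => ?_) fun n => ?_
  · show s ≤ _
    rw [le_div_iff₀ (by positivity)]
    push_cast
    exact (Nat.lt_floor_add_one _).le
  · show _ ≤ s + 1 / ((n : ℝ≥0) + 1)
    rw [div_le_iff₀ (by positivity), add_mul, one_div_mul_cancel (by positivity)]
    push_cast
    gcongr
    exact Nat.floor_le (by positivity)

theorem le_natFloor_succ_div (s : ℝ≥0) (n : ℕ) :
    s ≤ ((⌊s * (n + 1)⌋₊ + 1 : ℕ) : ℝ≥0) / (n + 1) := by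
  rw [le_div_iff₀ (by positivity)]
  push_cast
  exact (Nat.lt_floor_add_one _).le

/-- Evaluating a right-continuous process at a random time bounded by `u` only uses the process
up to time `u`. -/
theorem measurable_eval_of_rightContinuous (Y : ℝ≥0 → α → E) (u : ℝ≥0)
    (hY : ∀ s ≤ u, Measurable (Y s))
    (hc : ∀ a s, ContinuousWithinAt (fun t => Y t a) (Ici s) s)
    (S : α → ℝ≥0) (hS : Measurable S) (hSu : ∀ a, S a ≤ u) :
    Measurable fun a => Y (S a) a := by
  -- Approximating times lie on a countable grid to the right of `S`; capping them at `u` keeps the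
  -- evaluation inside the available information.
  refine measurable_of_tendsto_metrizable
    (f := fun (n : ℕ) a => Y (min (((⌊S a * (n + 1)⌋₊ + 1 : ℕ) : ℝ≥0) / (n + 1)) u) a)
    (fun n => ?_) ?_
  · have h1 (φ : ℕ → ℝ≥0) (hφ : ∀ k, φ k ≤ u) : Measurable fun q : ℕ × α => Y (φ q.1) q.2 :=
      measurable_from_prod_countable_right fun k => hY (φ k) (hφ k)
    have h2 (φ : ℕ → ℝ≥0) (hφ : ∀ k, φ k ≤ u) (k : α → ℕ) (hk : Measurable k) :
        Measurable fun a => Y (φ (k a)) a := (h1 φ hφ).comp (hk.prodMk measurable_id)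
    have h3 : Measurable fun a => ⌊S a * (n + 1)⌋₊ := Nat.measurable_floor.comp (hS.mul_const _)
    exact h2 (fun k => min (((k + 1 : ℕ) : ℝ≥0) / (n + 1)) u) (fun k => min_le_right _ _) _ h3
  · rw [tendsto_pi_nhds]
    intro a
    refine (hc a (S a)).tendsto.comp (tendsto_nhdsWithin_iff.2 ⟨?_, .of_forall fun n => ?_⟩)
    · have := (tendsto_natFloor_succ_div (S a)).min (tendsto_const_nhds (x := u))
      rwa [min_eq_left (hSu a)] at this
    · exact le_min (le_natFloor_succ_div _ _) (hSu a)

/-- Only `min (T a) u` matters on the event, and its measurability needs the sets `{T < v}` for `v ≤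
u` alone. This is what allows the σ-field on `α` to be the past up to `u`. -/
theorem measurableSet_eval_of_rightContinuous (Y : ℝ≥0 → α → E) (u : ℝ≥0)
    (hY : ∀ s ≤ u, Measurable (Y s))
    (hc : ∀ a s, ContinuousWithinAt (fun t => Y t a) (Ici s) s)
    (T : α → ℝ≥0∞) (hT : ∀ v ≤ u, MeasurableSet {a | T a < v}) {A : Set E}
    (hA : MeasurableSet A) : MeasurableSet {a | T a < u ∧ Y (T a).toNNReal a ∈ A} := by
  have hm : Measurable fun a => min (T a) u := by
    refine measurable_of_Iio fun v => ?_
    rcases lt_or_ge (u : ℝ≥0∞) v with h | h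
    · convert MeasurableSet.univ
      ext a; simp [h]
    · lift v to ℝ≥0 using ne_top_of_le_ne_top ENNReal.coe_ne_top h
      convert hT v (by exact_mod_cast h) using 1
      ext a
      simp only [mem_preimage, mem_Iio, min_lt_iff, mem_ofPred_eq]
      exact ⟨fun h' => h'.elim id fun h' => absurd h' (not_lt.2 h), Or.inl⟩
  have h := measurable_eval_of_rightContinuous Y u hY hc _ hm.ennreal_toNNReal
    (fun a => by simpa using ENNReal.toNNReal_mono ENNReal.coe_ne_top (min_le_right (T a) u))
  convert (hT u le_rfl).inter (h hA) using 1
  ext a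
  simp only [mem_ofPred_eq, mem_inter_iff, mem_preimage]
  refine and_congr_right fun ha => ?_
  rw [min_eq_left ha.le]

end RightContinuous

/-! ### Path space: shifts, optional times and prior events -/

/-- The space of cad-lag paths. -/
abbrev CadlagPath (E : Type*) [TopologicalSpace E] := {p : ℝ≥0 → E // IsCadlag p}

namespace CadlagPath

variable {E : Type*} [TopologicalSpace E]

/-- The path seen from time `s` on. -/
def shift (s : ℝ≥0) (p : CadlagPath E) : CadlagPath E :=
  ⟨fun t => p.1 (s + t), by
    refine ⟨fun t => ?_, fun t ht => ?_⟩
    · refine (p.2.1 (s + t)).comp (t := Ici (s + t)) (f := fun t => s + t)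
        (by fun_prop) fun u hu => ?_
      simpa using hu
    · obtain ⟨l, hl⟩ := p.2.2 (s + t) (by positivity)
      refine ⟨l, hl.comp (tendsto_nhdsWithin_iff.2 ⟨?_, ?_⟩)⟩
      · exact ((continuous_const.add continuous_id).tendsto t).mono_left nhdsWithin_le_nhds
      · filter_upwards [self_mem_nhdsWithin] with u hu
        simpa using hu⟩

@[simp] theorem shift_apply (s t : ℝ≥0) (p : CadlagPath E) : (shift s p).1 t = p.1 (s + t) := rfl

theorem shift_shift (s t : ℝ≥0) (p : CadlagPath E) : shift s (shift t p) = shift (t + s) p := by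
  ext u; simp [add_assoc]

@[simp] theorem shift_zero (p : CadlagPath E) : shift 0 p = p := by ext u; simp

/-- The first time at or after `T` at which the path is in `U`. -/
noncomputable def hitAfter (U : Set E) (T : CadlagPath E → ℝ≥0∞) (p : CadlagPath E) : ℝ≥0∞ :=
  ⨅ (t : ℝ≥0) (_ : T p ≤ t ∧ p.1 t ∈ U), (t : ℝ≥0∞)

theorem hitAfter_lt_iff {U : Set E} {T : CadlagPath E → ℝ≥0∞} {p : CadlagPath E} {u : ℝ≥0∞} :
    hitAfter U T p < u ↔ ∃ t : ℝ≥0, T p ≤ t ∧ p.1 t ∈ U ∧ (t : ℝ≥0∞) < u := by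
  simp [hitAfter, iInf_lt_iff, and_assoc]

variable [MeasurableSpace E]

/-- The σ-field of events up to time `u`. -/
abbrev past (E : Type*) [TopologicalSpace E] [MeasurableSpace E] (u : ℝ≥0) :
    MeasurableSpace (CadlagPath E) :=
  ⨆ s ∈ Iic u, MeasurableSpace.comap (fun p : CadlagPath E => p.1 s) inferInstance

theorem measurable_eval (s : ℝ≥0) : Measurable fun p : CadlagPath E => p.1 s :=
  (measurable_pi_apply s).comp measurable_subtype_coe

theorem past_le (u : ℝ≥0) : past E u ≤ (inferInstance : MeasurableSpace (CadlagPath E)) :=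
  iSup₂_le fun s _ => (measurable_eval s).comap_le

theorem past_mono {u v : ℝ≥0} (h : u ≤ v) : past E u ≤ past E v :=
  biSup_mono fun _ hs => le_trans hs h

theorem measurable_past_eval {s u : ℝ≥0} (h : s ≤ u) :
    Measurable[past E u] fun p : CadlagPath E => p.1 s :=
  Measurable.of_comap_le (le_iSup₂_of_le s h le_rfl)

theorem measurable_of_eval {α : Type*} [MeasurableSpace α] {g : α → CadlagPath E}
    (h : ∀ t, Measurable fun a => (g a).1 t) : Measurable g :=
  (measurable_pi_iff.2 h).subtype_mk (h := fun a => (g a).2)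

/-- `T` is an optional time. -/
def IsOptional (T : CadlagPath E → ℝ≥0∞) : Prop := ∀ u : ℝ≥0, MeasurableSet[past E u] {p | T p < u}

/-- `F` is, on `{T < ∞}`, an event prior to the optional time `T`. -/
def IsPrior (T : CadlagPath E → ℝ≥0∞) (F : Set (CadlagPath E)) : Prop :=
  ∀ u : ℝ≥0, MeasurableSet[past E u] {p | p ∈ F ∧ T p < u}

namespace IsOptional

variable {T : CadlagPath E → ℝ≥0∞}

theorem measurable (hT : IsOptional T) : Measurable T := by
  refine measurable_of_Iio fun v => ?_
  rcases eq_or_ne v ∞ with rfl | hv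
  · have : T ⁻¹' Iio ∞ = ⋃ n : ℕ, {p | T p < (n : ℝ≥0)} := by
      ext p
      simp only [mem_preimage, mem_Iio, mem_iUnion, mem_ofPred_eq, ENNReal.coe_natCast]
      exact ⟨fun h => ENNReal.exists_nat_gt h.ne, fun ⟨n, hn⟩ => hn.trans (by simp)⟩
    rw [this]
    exact .iUnion fun n => past_le _ _ (hT n)
  · lift v to ℝ≥0 using hv
    exact past_le _ _ (hT v)

theorem const (s : ℝ≥0) : IsOptional fun _ : CadlagPath E => (s : ℝ≥0∞) :=
  fun _ => MeasurableSet.const _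

theorem add_const (hT : IsOptional T) (s : ℝ≥0) : IsOptional fun p => T p + s := by
  intro u
  rcases le_or_gt u s with h | h
  · convert @MeasurableSet.empty _ (past E u)
    ext p
    simp only [mem_ofPred_eq, mem_empty_iff_false, iff_false, not_lt]
    exact le_trans (by exact_mod_cast h) le_add_self
  · convert past_mono (tsub_le_self (a := u) (b := s)) _ (hT (u - s)) using 1
    ext p
    simp only [mem_ofPred_eq, ENNReal.coe_sub]
    exact lt_tsub_iff_right.symm

theorem iSup {T : ℕ → CadlagPath E → ℝ≥0∞} (hT : ∀ n, IsOptional (T n)) :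
    IsOptional fun p => ⨆ n, T n p := by
  intro u
  -- A supremum of values below `u` may equal `u`, hence the rational `q` strictly between.
  have : {p : CadlagPath E | ⨆ n, T n p < u} = ⋃ q : ℚ, ⋃ _ : Real.toNNReal q < u,
      ⋂ n, {p | T n p < (Real.toNNReal q : ℝ≥0∞)} := by
    ext p
    simp only [mem_ofPred_eq, mem_iUnion, mem_iInter, exists_prop]
    constructor
    · intro h
      obtain ⟨q, _, h1, h2⟩ := ENNReal.lt_iff_exists_rat_btwn.1 h
      exact ⟨q, by exact_mod_cast h2, fun n => (le_iSup (fun n => T n p) n).trans_lt h1⟩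
    · rintro ⟨q, h1, h2⟩
      exact (iSup_le fun n => (h2 n).le).trans_lt (by exact_mod_cast h1)
  rw [this]
  exact .iUnion fun q => .iUnion fun hq => .iInter fun n => past_mono hq.le _ (hT n _)

theorem isPrior_univ (hT : IsOptional T) : IsPrior T univ := fun u => by simpa using hT u

theorem isPrior_toNNReal (hT : IsOptional T) {J : Set ℝ≥0} (hJ : MeasurableSet J) :
    IsPrior T {p | (T p).toNNReal ∈ J} := by
  intro u
  have := @measurableSet_eval_of_rightContinuous ℝ≥0 (CadlagPath E) _ _ _ _ (past E u)
    (fun s p => s) u (fun s hs => measurable_const) (fun p s => continuousWithinAt_id) T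
    (fun v hv => past_mono hv _ (hT v)) J hJ
  convert this using 1
  ext p; simp [and_comm]

end IsOptional

namespace IsPrior

variable {T : CadlagPath E → ℝ≥0∞} {F F' : Set (CadlagPath E)}

theorem inter (h : IsPrior T F) (h' : IsPrior T F') : IsPrior T (F ∩ F') := by
  intro u
  convert (h u).inter (h' u) using 1
  ext p; simp only [mem_inter_iff, mem_ofPred_eq]; tauto

theorem mono {T' : CadlagPath E → ℝ≥0∞} (h : IsPrior T F) (hT' : IsOptional T') (hle : T ≤ T') :
    IsPrior T' F := by
  intro u
  convert (h u).inter (hT' u) using 1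
  ext p
  simp only [mem_inter_iff, mem_ofPred_eq]
  exact ⟨fun h => ⟨⟨h.1, (hle p).trans_lt h.2⟩, h.2⟩, fun h => ⟨h.1.1, h.2⟩⟩

theorem of_past {L : ℝ≥0} (hF : MeasurableSet[past E L] F) (hT : IsOptional T)
    (hL : ∀ p, L ≤ T p) : IsPrior T F := by
  intro u
  rcases le_or_gt u L with h | h
  · convert @MeasurableSet.empty _ (past E u)
    ext p
    simp only [mem_ofPred_eq, mem_empty_iff_false, iff_false, not_and, not_lt]
    exact fun _ => le_trans (by exact_mod_cast h) (hL p)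
  · exact (past_mono h.le _ hF).inter (hT u)

theorem measurableSet (h : IsPrior T F) : MeasurableSet {p | p ∈ F ∧ T p ≠ ∞} := by
  have : {p | p ∈ F ∧ T p ≠ ∞} = ⋃ n : ℕ, {p | p ∈ F ∧ T p < (n : ℝ≥0)} := by
    ext p
    simp only [mem_iUnion, mem_ofPred_eq, ENNReal.coe_natCast]
    exact ⟨fun h => (ENNReal.exists_nat_gt h.2).imp fun n hn => ⟨h.1, hn⟩,
      fun ⟨n, h, hn⟩ => ⟨h, (hn.trans (by simp)).ne⟩⟩
  rw [this]
  exact .iUnion fun n => past_le _ _ (h n)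

end IsPrior

/-- By right-continuity a visit to an open set persists for a short while, so it can be detected at
a rational time strictly later than `T` and still before `u`. -/
theorem isOptional_hitAfter [OpensMeasurableSpace E] {U : Set E} (hU : IsOpen U)
    {T : CadlagPath E → ℝ≥0∞}
    (hT : IsOptional T) : IsOptional (hitAfter U T) := by
  intro u
  have : {p | hitAfter U T p < u} = ⋃ q : ℚ, ⋃ _ : Real.toNNReal q < u,
      {p | T p < Real.toNNReal q} ∩ {p | p.1 (Real.toNNReal q) ∈ U} := by
    ext p
    simp only [mem_ofPred_eq, mem_iUnion, exists_prop, mem_inter_iff, hitAfter_lt_iff]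
    constructor
    · rintro ⟨t, h1, h2, h3⟩
      have h3' : t < u := by exact_mod_cast h3
      have h4 : ∀ᶠ s in 𝓝[≥] t, p.1 s ∈ U := (p.2.1 t).eventually (hU.mem_nhds h2)
      have h5 : ∀ᶠ s in 𝓝[>] t, p.1 s ∈ U ∧ s ∈ Ioo t u :=
        (h4.filter_mono (nhdsWithin_mono _ Ioi_subset_Ici_self)).and (Ioo_mem_nhdsGT h3')
      obtain ⟨v, hv, hv'⟩ := (mem_nhdsGT_iff_exists_Ioo_subset' h3').1 h5
      obtain ⟨q, _, h6, h7⟩ := NNReal.lt_iff_exists_rat_btwn t v |>.1 hv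
      have h8 := hv' ⟨h6, h7⟩
      exact ⟨q, h8.2.2, h1.trans_lt (by exact_mod_cast h6), h8.1⟩
    · rintro ⟨q, h1, h2, h3⟩
      exact ⟨_, h2.le, h3, by exact_mod_cast h1⟩
  rw [this]
  exact .iUnion fun q => .iUnion fun hq => (past_mono hq.le _ (hT _)).inter
    (measurable_past_eval hq.le hU.measurableSet)

section Metrizable

variable [TopologicalSpace.PseudoMetrizableSpace E] [BorelSpace E]

theorem measurable_uncurry_eval : Measurable fun q : ℝ≥0 × CadlagPath E => q.2.1 q.1 := by
  intro A hA
  have h (u : ℕ) := measurableSet_eval_of_rightContinuous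
    (fun s (q : ℝ≥0 × CadlagPath E) => q.2.1 s) u
    (fun s _ => (measurable_eval s).comp measurable_snd) (fun q s => q.2.2.1 s)
    (fun q => (q.1 : ℝ≥0∞)) (fun v _ => measurableSet_lt (by fun_prop) measurable_const) hA
  convert MeasurableSet.iUnion h
  ext q
  obtain ⟨n, hn⟩ := exists_nat_gt q.1
  simp only [mem_preimage, ENNReal.toNNReal_coe, mem_iUnion, mem_ofPred_eq]
  exact ⟨fun h => ⟨n, by exact_mod_cast hn, h⟩, fun ⟨_, _, h⟩ => h⟩

theorem _root_.Measurable.cadlagPath_eval {α : Type*} [MeasurableSpace α] {S : α → ℝ≥0}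
    {g : α → CadlagPath E} (hS : Measurable S) (hg : Measurable g) :
    Measurable fun a => (g a).1 (S a) :=
  measurable_uncurry_eval.comp (hS.prodMk hg)

theorem _root_.Measurable.cadlagPath_shift {α : Type*} [MeasurableSpace α] {S : α → ℝ≥0}
    {g : α → CadlagPath E} (hS : Measurable S) (hg : Measurable g) :
    Measurable fun a => shift (S a) (g a) :=
  measurable_of_eval fun t => (hS.add_const t).cadlagPath_eval hg

theorem IsOptional.isPrior_eval {T : CadlagPath E → ℝ≥0∞} (hT : IsOptional T) {A : Set E}
    (hA : MeasurableSet A) :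
    IsPrior T {p | p.1 (T p).toNNReal ∈ A} := by
  intro u
  have := @measurableSet_eval_of_rightContinuous E (CadlagPath E) _ _ _ _ (past E u)
    (fun s p => p.1 s) u (fun s hs => measurable_past_eval hs) (fun p s => p.2.1 s) T
    (fun v hv => past_mono hv _ (hT v)) A hA
  convert this using 1
  ext p; simp [and_comm]

end Metrizable

end CadlagPath

/-! ### Cylinder events, coded by successive delays -/

namespace CadlagPath

variable {E : Type*} [TopologicalSpace E]

/-- The event that the path is in `A` after the first delay `s`, and from that time on satisfies the
remaining constraints. -/
def cylinder : List (ℝ≥0 × Set E) → Set (CadlagPath E)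
  | [] => univ
  | a :: l => {p | p.1 a.1 ∈ a.2 ∧ shift a.1 p ∈ cylinder l}

theorem mem_cylinder_cons {a : ℝ≥0 × Set E} {l : List (ℝ≥0 × Set E)} {p : CadlagPath E} :
    p ∈ cylinder (a :: l) ↔ p.1 a.1 ∈ a.2 ∧ shift a.1 p ∈ cylinder l := Iff.rfl

theorem shift_mem_cylinder_cons {s t : ℝ≥0} (h : s ≤ t) {A : Set E} {l : List (ℝ≥0 × Set E)}
    {p : CadlagPath E} : shift s p ∈ cylinder ((t - s, A) :: l) ↔ p ∈ cylinder ((t, A) :: l) := by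
  simp only [mem_cylinder_cons, shift_apply, shift_shift, add_tsub_cancel_of_le h]

variable [MeasurableSpace E]

/-- The two lists are merged: the smaller first delay is taken out, and the other first delay is
reduced by it. The bound `n` on the total length drives the induction. -/
theorem exists_cylinder_inter (n : ℕ) (l l' : List (ℝ≥0 × Set E)) (hn : l.length + l'.length ≤ n)
    (hl : ∀ a ∈ l, MeasurableSet a.2) (hl' : ∀ a ∈ l', MeasurableSet a.2) :
    ∃ k : List (ℝ≥0 × Set E), (∀ a ∈ k, MeasurableSet a.2) ∧
      cylinder k = cylinder l ∩ cylinder l' := by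
  induction n generalizing l l' with
  | zero =>
    obtain rfl : l = [] := List.length_eq_zero_iff.1 (by omega)
    exact ⟨l', hl', by simp [cylinder]⟩
  | succ n ih =>
    rcases l with _ | ⟨⟨s, A⟩, l⟩
    · exact ⟨l', hl', by simp [cylinder]⟩
    rcases l' with _ | ⟨⟨t, B⟩, l'⟩
    · exact ⟨_, hl, by simp [cylinder]⟩
    simp only [List.forall_mem_cons] at hl hl'
    simp only [List.length_cons] at hn
    rcases le_total s t with h | h
    · obtain ⟨k, hk, hk'⟩ := ih l ((t - s, B) :: l') (by simp; omega) hl.2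
        (by simpa using hl')
      refine ⟨(s, A) :: k, by simpa using ⟨hl.1, fun a b => hk (a, b)⟩, ?_⟩
      ext p
      rw [mem_cylinder_cons, hk', mem_inter_iff, mem_inter_iff, shift_mem_cylinder_cons h,
        mem_cylinder_cons (l := l), and_assoc]
    · obtain ⟨k, hk, hk'⟩ := ih ((s - t, A) :: l) l' (by simp; omega) (by simpa using hl) hl'.2
      refine ⟨(t, B) :: k, by simpa using ⟨hl'.1, fun a b => hk (a, b)⟩, ?_⟩
      ext p
      rw [mem_cylinder_cons, hk', mem_inter_iff, mem_inter_iff, shift_mem_cylinder_cons h,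
        mem_cylinder_cons (l := l')]
      tauto

theorem isPiSystem_cylinder : IsPiSystem
    {S : Set (CadlagPath E) | ∃ l, (∀ a ∈ l, MeasurableSet a.2) ∧ cylinder l = S} := by
  rintro _ ⟨l, hl, rfl⟩ _ ⟨l', hl', rfl⟩ -
  exact exists_cylinder_inter _ l l' le_rfl hl hl'

variable [TopologicalSpace.PseudoMetrizableSpace E] [BorelSpace E]

theorem measurableSet_cylinder : ∀ (l : List (ℝ≥0 × Set E)), (∀ a ∈ l, MeasurableSet a.2) →
    MeasurableSet (cylinder l)
  | [], _ => .univ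
  | a :: l, h => by
    simp only [List.forall_mem_cons] at h
    exact (measurable_eval a.1 h.1).inter
      ((measurable_const.cadlagPath_shift measurable_id) (measurableSet_cylinder l h.2))

theorem generateFrom_cylinder : (inferInstance : MeasurableSpace (CadlagPath E)) =
    MeasurableSpace.generateFrom
      {S : Set (CadlagPath E) | ∃ l, (∀ a ∈ l, MeasurableSet a.2) ∧ cylinder l = S} := by
  refine le_antisymm ?_ (MeasurableSpace.generateFrom_le ?_)
  · rw [show (inferInstance : MeasurableSpace (CadlagPath E)) =
      MeasurableSpace.comap Subtype.val MeasurableSpace.pi from rfl, MeasurableSpace.pi,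
      MeasurableSpace.comap_iSup]
    refine iSup_le fun t => ?_
    rw [MeasurableSpace.comap_comp]
    rintro _ ⟨A, hA, rfl⟩
    exact MeasurableSpace.measurableSet_generateFrom
      ⟨[(t, A)], by simpa using hA, by ext p; simp [cylinder]⟩
  · rintro _ ⟨l, hl, rfl⟩
    exact measurableSet_cylinder l hl

theorem measurable_eval_toNNReal {T : CadlagPath E → ℝ≥0∞} (hT : IsOptional T) :
    Measurable fun p : CadlagPath E => p.1 (T p).toNNReal :=
  hT.measurable.ennreal_toNNReal.cadlagPath_eval measurable_id

theorem measurable_shift_toNNReal {T : CadlagPath E → ℝ≥0∞} (hT : IsOptional T) :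
    Measurable fun p : CadlagPath E => shift (T p).toNNReal p :=
  hT.measurable.ennreal_toNNReal.cadlagPath_shift measurable_id

end CadlagPath

/-! ### The strong Markov property for the whole path -/

namespace StrongMarkovFamily

open CadlagPath

section Basic

variable {E Ω : Type*} [TopologicalSpace E] [MeasurableSpace E] [MeasurableSpace Ω]
  (M : StrongMarkovFamily E Ω)

instance (x : E) : IsProbabilityMeasure (M.law x) := M.isProbabilityMeasure_law x

/-- The whole path of the process. -/
def path (ω : Ω) : CadlagPath E := ⟨fun t => M.X t ω, M.cadlag ω⟩

@[simp] theorem path_apply (ω : Ω) (t : ℝ≥0) : (M.path ω).1 t = M.X t ω := rfl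

theorem measurableSet_preimage_path {u : ℝ≥0} {S : Set (CadlagPath E)}
    (hS : MeasurableSet[past E u] S) : MeasurableSet[M.filtration u] (M.path ⁻¹' S) := by
  have : past E u ≤ MeasurableSpace.map M.path (M.filtration u) := by
    refine iSup₂_le fun s hs => ?_
    rintro _ ⟨A, hA, rfl⟩
    exact M.filtration.mono hs _ (M.adapted s hA)
  exact this _ hS

theorem measurable_path : Measurable M.path :=
  measurable_of_eval fun t => (M.adapted t).mono (M.filtration.le t) le_rfl

instance isMarkovKernel_trans (t : ℝ≥0) : IsMarkovKernel (M.trans t) :=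
  ⟨fun x => ⟨by rw [← M.law_apply t x univ .univ]; simp⟩⟩

/-- The probability of a cylinder event, as a function of the starting point. -/
noncomputable def cylinderProb : List (ℝ≥0 × Set E) → E → ℝ≥0∞
  | [], _ => 1
  | a :: l, x => ∫⁻ y in a.2, cylinderProb l y ∂M.trans a.1 x

theorem measurable_cylinderProb : ∀ (l : List (ℝ≥0 × Set E)), (∀ a ∈ l, MeasurableSet a.2) →
    Measurable (M.cylinderProb l)
  | [], _ => measurable_const
  | a :: l, h => by
    simp only [List.forall_mem_cons] at h
    exact (measurable_cylinderProb l h.2).setLIntegral_kernel h.1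

theorem lintegral_path_initial (x : E) {g : E → ℝ≥0∞} (hg : Measurable g) :
    ∫⁻ p, g (p.1 0) ∂(M.law x).map M.path = g x := by
  have hg' : Measurable fun p : CadlagPath E => g (p.1 0) := hg.comp (measurable_eval 0)
  rw [lintegral_map hg' M.measurable_path]
  calc _ = ∫⁻ _, g x ∂M.law x := lintegral_congr_ae <| by
        filter_upwards [M.initial x] with ω hω
        simp [hω]
    _ = g x := by simp

end Basic

variable {E Ω : Type*} [TopologicalSpace E] [TopologicalSpace.PseudoMetrizableSpace E]
  [MeasurableSpace E] [BorelSpace E] [MeasurableSpace Ω] (M : StrongMarkovFamily E Ω)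

/-- Transport along `M.path`: an optional time on path space pulls back to a stopping time of the
right-continuous filtration, and a prior event to an event of its σ-field. -/
theorem strong_markov_path (x : E) {T : CadlagPath E → ℝ≥0∞} (hT : IsOptional T)
    {F : Set (CadlagPath E)} (hF : IsPrior T F) (s : ℝ≥0) {A : Set E} (hA : MeasurableSet A) :
    (M.law x).map M.path {p | (p ∈ F ∧ T p ≠ ∞) ∧ p.1 ((T p).toNNReal + s) ∈ A} =
      ∫⁻ p in {p | p ∈ F ∧ T p ≠ ∞}, M.trans s (p.1 (T p).toNNReal) A
        ∂(M.law x).map M.path := by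
  have hle (u : ℝ≥0) {G : Set (CadlagPath E)} (hG : ∀ v : ℝ≥0, MeasurableSet[past E v]
      {p | p ∈ G ∧ T p < v}) : MeasurableSet[M.filtration.rightCont u]
        {ω | M.path ω ∈ G ∧ T (M.path ω) ≤ u} := by
    rw [Filtration.rightCont_eq]
    simp only [MeasurableSpace.measurableSet_iInf]
    intro v hv
    -- For fixed `v > u`, capping `u + 1/(n+1)` at `v` keeps every event of the intersection in the
    -- σ-field at time `v`.
    have : {ω | M.path ω ∈ G ∧ T (M.path ω) ≤ u} =
        ⋂ n : ℕ, M.path ⁻¹' {p | p ∈ G ∧ T p < (min v (u + 1 / (n + 1)) : ℝ≥0)} := by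
      ext ω
      simp only [mem_ofPred_eq, mem_iInter, mem_preimage]
      refine ⟨fun h n => ⟨h.1, h.2.trans_lt ?_⟩, fun h => ⟨(h 0).1, ?_⟩⟩
      · exact_mod_cast lt_min hv (lt_add_of_pos_right _ (by positivity))
      · refine ge_of_tendsto' (f := fun n : ℕ => ((u + 1 / ((n : ℝ≥0) + 1) : ℝ≥0) : ℝ≥0∞))
          (x := atTop) ?_ fun n => (h n).2.le.trans (by exact_mod_cast min_le_right _ _)
        refine ENNReal.tendsto_coe.2 ?_
        simpa using tendsto_const_nhds.add (tendsto_one_div_add_atTop_nhds_zero_nat (𝕜 := ℝ≥0))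
    rw [this]
    exact .iInter fun n => M.filtration.mono (min_le_left _ _) _
      (M.measurableSet_preimage_path (hG _))
  have hτ : IsStoppingTime M.filtration.rightCont
      (fun ω => (T (M.path ω) : WithTop ℝ≥0)) := fun u => by
    convert hle u hT.isPrior_univ using 1
    ext ω
    exact ⟨fun h => ⟨mem_univ _, h⟩, fun h => h.2⟩
  have hFT : MeasurableSet[hτ.measurableSpace] (M.path ⁻¹' {p | p ∈ F ∧ T p ≠ ∞}) := by
    refine ⟨?_, fun u => ?_⟩
    · have : M.path ⁻¹' {p | p ∈ F ∧ T p ≠ ∞} =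
          ⋃ n : ℕ, {ω | M.path ω ∈ F ∧ T (M.path ω) ≤ (n : ℝ≥0)} := by
        ext ω
        simp only [mem_iUnion, mem_ofPred_eq, mem_preimage, ENNReal.coe_natCast]
        exact ⟨fun h => (ENNReal.exists_nat_gt h.2).imp fun n hn => ⟨h.1, hn.le⟩,
          fun ⟨n, h, hn⟩ => ⟨h, (hn.trans_lt (by simp)).ne⟩⟩
      rw [this]
      exact .iUnion fun n => (le_iSup (fun t => M.filtration.rightCont t) (n : ℝ≥0)) _ (hle n hF)
    · convert hle u hF using 1
      ext ω
      simp only [mem_inter_iff, mem_preimage, mem_ofPred_eq]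
      exact ⟨fun h => ⟨h.1.1, h.2⟩,
        fun h => ⟨⟨h.1, ne_top_of_le_ne_top ENNReal.coe_ne_top h.2⟩, h.2⟩⟩
  have key : M.law x {ω | M.path ω ∈ {p | p ∈ F ∧ T p ≠ ∞} ∧ T (M.path ω) ≠ ∞ ∧
        M.X ((T (M.path ω)).toNNReal + s) ω ∈ A} =
      ∫⁻ ω in {ω | M.path ω ∈ {p | p ∈ F ∧ T p ≠ ∞} ∧ T (M.path ω) ≠ ∞},
        M.trans s (M.X (T (M.path ω)).toNNReal ω) A ∂M.law x :=
    M.strong_markov x _ hτ s A hA _ hFT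
  have hm1 : MeasurableSet {p : CadlagPath E | p.1 ((T p).toNNReal + s) ∈ A} :=
    (hT.measurable.ennreal_toNNReal.add_const s).cadlagPath_eval measurable_id hA
  have hm2 : Measurable fun p : CadlagPath E => M.trans s (p.1 (T p).toNNReal) A :=
    ((M.trans s).measurable_coe hA).comp (measurable_eval_toNNReal hT)
  have e1 : {p | (p ∈ F ∧ T p ≠ ∞) ∧ p.1 ((T p).toNNReal + s) ∈ A} =
      {p | p ∈ F ∧ T p ≠ ∞} ∩ {p | p.1 ((T p).toNNReal + s) ∈ A} := rfl
  rw [e1, Measure.map_apply M.measurable_path (hF.measurableSet.inter hm1),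
    setLIntegral_map hF.measurableSet hm2 M.measurable_path]
  have e : {ω | M.path ω ∈ {p | p ∈ F ∧ T p ≠ ∞} ∧ T (M.path ω) ≠ ∞} =
      M.path ⁻¹' {p | p ∈ F ∧ T p ≠ ∞} := by
    ext ω
    exact ⟨fun h => h.1, fun h => ⟨h, h.2⟩⟩
  rw [e] at key
  simp only [path_apply]
  rw [← key]
  congr 1
  ext ω
  simp only [mem_inter_iff, mem_preimage, mem_ofPred_eq, path_apply]
  exact ⟨fun h => ⟨h.1, h.1.2, h.2⟩, fun h => ⟨h.1, h.2.2⟩⟩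

theorem map_eval_add_eq_bind (x : E) {T : CadlagPath E → ℝ≥0∞} (hT : IsOptional T)
    {F : Set (CadlagPath E)} (hF : IsPrior T F) (s : ℝ≥0) :
    (((M.law x).map M.path).restrict {p | p ∈ F ∧ T p ≠ ∞}).map
        (fun p => p.1 ((T p).toNNReal + s)) =
      ((((M.law x).map M.path).restrict {p | p ∈ F ∧ T p ≠ ∞}).map
        fun p => p.1 (T p).toNNReal).bind (M.trans s) := by
  have hm : Measurable fun p : CadlagPath E => p.1 ((T p).toNNReal + s) :=
    (hT.measurable.ennreal_toNNReal.add_const s).cadlagPath_eval measurable_id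
  ext A hA
  rw [Measure.map_apply hm hA, Measure.restrict_apply (hm hA),
    Measure.bind_apply hA (M.trans s).aemeasurable, lintegral_map ((M.trans s).measurable_coe hA)
      (measurable_eval_toNNReal hT), ← M.strong_markov_path x hT hF s hA, inter_comm]
  rfl

/-- Induction on the list: the first constraint is absorbed into the prior event, the induction
hypothesis is used at the optional time `T + s`, and the one-time property carries the result back
to `T`. Quantifying over `T` and `F` inside is therefore essential. -/
theorem strong_markov_cylinder (x : E) : ∀ (l : List (ℝ≥0 × Set E)),
    (∀ a ∈ l, MeasurableSet a.2) → ∀ {T : CadlagPath E → ℝ≥0∞} (_ : IsOptional T)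
    {F : Set (CadlagPath E)} (_ : IsPrior T F),
    (M.law x).map M.path {p | (p ∈ F ∧ T p ≠ ∞) ∧ shift (T p).toNNReal p ∈ cylinder l} =
      ∫⁻ p in {p | p ∈ F ∧ T p ≠ ∞}, M.cylinderProb l (p.1 (T p).toNNReal)
        ∂(M.law x).map M.path
  | [], _, T, hT, F, hF => by
    simp [CadlagPath.cylinder, cylinderProb]
  | (s, A) :: l, h, T, hT, F, hF => by
    simp only [List.forall_mem_cons] at h
    have hT' := hT.add_const s
    have hF' := (hF.mono hT' (fun p => le_self_add)).inter (hT'.isPrior_eval h.1)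
    have key := strong_markov_cylinder x l h.2 hT' hF'
    have e1 (p : CadlagPath E) : T p ≠ ∞ → (T p + s).toNNReal = (T p).toNNReal + s := fun h => by
      rw [ENNReal.toNNReal_add h ENNReal.coe_ne_top, ENNReal.toNNReal_coe]
    have e2 : {p | (p ∈ F ∩ {p | p.1 (T p + s).toNNReal ∈ A} ∧ T p + s ≠ ∞) ∧
        shift (T p + s).toNNReal p ∈ cylinder l} =
        {p | (p ∈ F ∧ T p ≠ ∞) ∧ shift (T p).toNNReal p ∈ cylinder ((s, A) :: l)} := by
      ext p
      by_cases hp : T p = ∞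
      · simp [hp]
      · simp only [mem_inter_iff, mem_ofPred_eq, mem_cylinder_cons, shift_apply, shift_shift,
          e1 p hp, ne_eq, ENNReal.add_eq_top, ENNReal.coe_ne_top, or_false]
        tauto
    have e3 : {p | p ∈ F ∩ {p | p.1 (T p + s).toNNReal ∈ A} ∧ T p + s ≠ ∞} =
        (fun p : CadlagPath E => p.1 ((T p).toNNReal + s)) ⁻¹' A ∩ {p | p ∈ F ∧ T p ≠ ∞} := by
      ext p
      by_cases hp : T p = ∞
      · simp [hp]
      · simp only [mem_inter_iff, mem_ofPred_eq, mem_preimage,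
          e1 p hp, ne_eq, ENNReal.add_eq_top, ENNReal.coe_ne_top, or_false]
        tauto
    have hm : Measurable fun p : CadlagPath E => p.1 ((T p).toNNReal + s) :=
      (hT.measurable.ennreal_toNNReal.add_const s).cadlagPath_eval measurable_id
    have hV := M.measurable_cylinderProb l h.2
    rw [e2] at key
    rw [key, e3]
    rw [← Measure.restrict_restrict (hm h.1)]
    calc _ = ∫⁻ p in (fun p : CadlagPath E => p.1 ((T p).toNNReal + s)) ⁻¹' A,
          M.cylinderProb l (p.1 ((T p).toNNReal + s))
            ∂((M.law x).map M.path).restrict {p | p ∈ F ∧ T p ≠ ∞} := by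
          rw [Measure.restrict_restrict (hm h.1)]
          refine setLIntegral_congr_fun ((hm h.1).inter hF.measurableSet) fun p hp => ?_
          simp only [e1 p hp.2.2]
      _ = ∫⁻ y in A, M.cylinderProb l y
          ∂(((M.law x).map M.path).restrict {p | p ∈ F ∧ T p ≠ ∞}).map
            (fun p => p.1 ((T p).toNNReal + s)) := (setLIntegral_map h.1 hV hm).symm
      _ = _ := by
          rw [M.map_eval_add_eq_bind x hT hF s, ← lintegral_indicator h.1,
            Measure.lintegral_bind (M.trans s).aemeasurable (hV.indicator h.1).aemeasurable,
            lintegral_map (hV.indicator h.1).lintegral_kernel (measurable_eval_toNNReal hT)]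
          simp only [lintegral_indicator h.1, cylinderProb]

theorem map_path_cylinder (x : E) {l : List (ℝ≥0 × Set E)} (hl : ∀ a ∈ l, MeasurableSet a.2) :
    (M.law x).map M.path (CadlagPath.cylinder l) = M.cylinderProb l x := by
  have h := M.strong_markov_cylinder x l hl (IsOptional.const 0)
    (IsOptional.const (E := E) 0).isPrior_univ
  simpa [lintegral_path_initial M x (M.measurable_cylinderProb l hl)] using h

/-- The law of the path, as a kernel in the starting point. -/
noncomputable def pathLaw : Kernel E (CadlagPath E) where
  toFun x := (M.law x).map M.path
  measurable' := by
    have (x : E) : IsProbabilityMeasure ((M.law x).map M.path) :=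
      Measure.isProbabilityMeasure_map M.measurable_path.aemeasurable
    refine Measurable.measure_of_isPiSystem_of_isProbabilityMeasure generateFrom_cylinder
      isPiSystem_cylinder ?_
    rintro _ ⟨l, hl, rfl⟩
    simp only [M.map_path_cylinder _ hl]
    exact M.measurable_cylinderProb l hl

theorem pathLaw_apply (x : E) : M.pathLaw x = (M.law x).map M.path := rfl

instance : IsMarkovKernel M.pathLaw :=
  ⟨fun _ => Measure.isProbabilityMeasure_map M.measurable_path.aemeasurable⟩

theorem pathLaw_eval (t : ℝ≥0) (x : E) {A : Set E} (hA : MeasurableSet A) :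
    M.pathLaw x {p | p.1 t ∈ A} = M.trans t x A := by
  rw [← M.law_apply t x A hA, pathLaw_apply]
  exact Measure.map_apply M.measurable_path (measurable_eval t hA)

/-- The strong Markov property for the law of the shifted path. -/
theorem map_shift_eq_bind (x : E) {T : CadlagPath E → ℝ≥0∞} (hT : IsOptional T)
    {F : Set (CadlagPath E)} (hF : IsPrior T F) :
    ((M.pathLaw x).restrict {p | p ∈ F ∧ T p ≠ ∞}).map (fun p => shift (T p).toNNReal p) =
      (((M.pathLaw x).restrict {p | p ∈ F ∧ T p ≠ ∞}).map
        fun p => p.1 (T p).toNNReal).bind M.pathLaw := by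
  have hm := measurable_shift_toNNReal hT
  have hm' := measurable_eval_toNNReal hT
  refine ext_of_generate_finite _ generateFrom_cylinder isPiSystem_cylinder ?_ ?_
  · rintro _ ⟨l, hl, rfl⟩
    have hC := measurableSet_cylinder l hl
    rw [Measure.map_apply hm hC, Measure.restrict_apply (hm hC),
      Measure.bind_apply hC M.pathLaw.aemeasurable,
      lintegral_map (M.pathLaw.measurable_coe hC) hm']
    simp only [pathLaw_apply, M.map_path_cylinder _ hl]
    rw [← M.strong_markov_cylinder x l hl hT hF, inter_comm]
    rfl
  · rw [Measure.map_apply hm .univ, Measure.bind_apply .univ M.pathLaw.aemeasurable]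
    simp [Measure.map_apply hm' .univ]

/-- Costs after `T` depend on the clock reading, so the joint law of `T` and the shifted path is
needed. On a rectangle `J ×ˢ H` the condition `T ∈ J` joins the prior event; the kernel `κ` keeps
the clock as a Dirac mass. -/
theorem lintegral_shift (x : E) {T : CadlagPath E → ℝ≥0∞} (hT : IsOptional T)
    {F : Set (CadlagPath E)} (hF : IsPrior T F) {G : ℝ≥0 × CadlagPath E → ℝ≥0∞}
    (hG : Measurable G) :
    ∫⁻ p in {p | p ∈ F ∧ T p ≠ ∞}, G ((T p).toNNReal, shift (T p).toNNReal p) ∂M.pathLaw x =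
      ∫⁻ p in {p | p ∈ F ∧ T p ≠ ∞}, ∫⁻ q, G ((T p).toNNReal, q) ∂M.pathLaw (p.1 (T p).toNNReal)
        ∂M.pathLaw x := by
  have hm := measurable_shift_toNNReal hT
  have hm' := measurable_eval_toNNReal hT
  have hT' := hT.measurable.ennreal_toNNReal
  set κ : Kernel (ℝ≥0 × E) (ℝ≥0 × CadlagPath E) :=
    Kernel.deterministic Prod.fst measurable_fst ×ₖ M.pathLaw.comap Prod.snd measurable_snd with hκ
  have hκa (a : ℝ≥0 × E) : κ a = (Measure.dirac a.1).prod (M.pathLaw a.2) := by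
    rw [hκ, Kernel.prod_apply, Kernel.deterministic_apply, Kernel.comap_apply]
  set μ := (M.pathLaw x).restrict {p | p ∈ F ∧ T p ≠ ∞} with hμ
  have key : μ.map (fun p => ((T p).toNNReal, shift (T p).toNNReal p)) =
      (μ.map fun p => ((T p).toNNReal, p.1 (T p).toNNReal)).bind κ := by
    refine Measure.ext_prod fun {J H} hJ hH => ?_
    rw [Measure.map_apply (hT'.prodMk hm) (hJ.prod hH),
      Measure.bind_apply (hJ.prod hH) κ.aemeasurable,
      lintegral_map (κ.measurable_coe (hJ.prod hH)) (hT'.prodMk hm')]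
    have hF' := hF.inter (hT.isPrior_toNNReal hJ)
    have h := congrArg (fun ν => ν H) (M.map_shift_eq_bind x hT hF')
    rw [Measure.map_apply hm hH, Measure.bind_apply hH M.pathLaw.aemeasurable,
      lintegral_map (M.pathLaw.measurable_coe hH) hm'] at h
    have e : {p | p ∈ F ∩ {p | (T p).toNNReal ∈ J} ∧ T p ≠ ∞} =
        (fun p => (T p).toNNReal) ⁻¹' J ∩ {p | p ∈ F ∧ T p ≠ ∞} := by
      ext p; simp only [mem_inter_iff, mem_ofPred_eq, mem_preimage]; tauto
    rw [e, ← Measure.restrict_restrict (hT' hJ), ← hμ, Measure.restrict_apply (hm hH),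
      ← lintegral_indicator (hT' hJ)] at h
    rw [mk_preimage_prod, inter_comm, h]
    refine lintegral_congr fun p => ?_
    rw [hκa, Measure.prod_prod, Measure.dirac_apply' _ hJ]
    by_cases hp : (T p).toNNReal ∈ J <;> simp [indicator, hp]
  have h := congrArg (fun ν => ∫⁻ z, G z ∂ν) key
  rw [lintegral_map hG (hT'.prodMk hm), Measure.lintegral_bind κ.aemeasurable hG.aemeasurable,
    lintegral_map hG.lintegral_kernel (hT'.prodMk hm')] at h
  rw [h]
  refine lintegral_congr fun p => ?_
  rw [hκa, lintegral_prod _ hG.aemeasurable, lintegral_dirac' _ hG.lintegral_prod_right']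

/-- The Markov property at a fixed time. -/
theorem lintegral_shift_const (x : E) (s : ℝ≥0) {G : CadlagPath E → ℝ≥0∞} (hG : Measurable G) :
    ∫⁻ p, G (shift s p) ∂M.pathLaw x = ∫⁻ p, ∫⁻ q, G q ∂M.pathLaw (p.1 s) ∂M.pathLaw x := by
  simpa using M.lintegral_shift x (IsOptional.const s) (IsOptional.const (E := E) s).isPrior_univ
    (hG.comp measurable_snd)

end StrongMarkovFamily

/-! ### Hitting times of closed sets -/

namespace CadlagPath

variable {E : Type*} [PseudoMetricSpace E]

theorem le_hitAfter (U : Set E) (T : CadlagPath E → ℝ≥0∞) (p : CadlagPath E) :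
    T p ≤ hitAfter U T p := le_iInf₂ fun _ h => h.1

theorem hitAfter_le {U : Set E} {T : CadlagPath E → ℝ≥0∞} {p : CadlagPath E} {t : ℝ≥0}
    (h : T p ≤ t) (h' : p.1 t ∈ U) : hitAfter U T p ≤ t := iInf₂_le t ⟨h, h'⟩

/-- A point outside a closed set is outside some closed thickening, and right-continuity keeps the
path outside it for a positive time. -/
theorem exists_lt_hitAfter_thickening {C : Set E} (hC : IsClosed C) {T : CadlagPath E → ℝ≥0∞}
    {p : CadlagPath E} (hT : T p ≠ ∞) (hp : p.1 (T p).toNNReal ∉ C) :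
    ∃ k : ℕ, T p < hitAfter (Metric.thickening (1 / ((k : ℝ) + 1)) C) T p := by
  have h1 : p.1 (T p).toNNReal ∉ ⋂ (δ : ℝ) (_ : 0 < δ), Metric.cthickening δ C := by
    rwa [← Metric.closure_eq_iInter_cthickening, hC.closure_eq]
  simp only [mem_iInter, not_forall] at h1
  obtain ⟨δ, hδ, h1⟩ := h1
  obtain ⟨k, hk⟩ := exists_nat_one_div_lt hδ
  refine ⟨k, ?_⟩
  set t := (T p).toNNReal with ht
  have htT : (t : ℝ≥0∞) = T p := ENNReal.coe_toNNReal hT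
  have h2 : ∀ᶠ s in 𝓝[>] t, p.1 s ∈ (Metric.cthickening δ C)ᶜ :=
    ((p.2.1 t).eventually (Metric.isClosed_cthickening.isOpen_compl.mem_nhds h1)).filter_mono
      (nhdsWithin_mono _ Ioi_subset_Ici_self)
  obtain ⟨v, hv, hv'⟩ := (mem_nhdsGT_iff_exists_Ioo_subset).1 h2
  refine lt_of_lt_of_le (b := (v : ℝ≥0∞)) (by rw [← htT]; exact_mod_cast hv) ?_
  refine le_iInf₂ fun s hs => ?_
  by_contra! hlt
  have hs1 : t ≤ s := by rw [← ENNReal.coe_le_coe, htT]; exact hs.1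
  have hs3 : p.1 s ∈ Metric.cthickening δ C :=
    Metric.thickening_subset_cthickening_of_le hk.le _ hs.2
  rcases hs1.eq_or_lt with h | h
  · exact h1 (h ▸ hs3)
  · exact hv' ⟨h, by exact_mod_cast hlt⟩ hs3

variable [MeasurableSpace E] [BorelSpace E]

/-- The hitting time of a closed set is almost surely equal to an optional time, which moreover
never exceeds it. -/
theorem exists_isOptional_eval_mem_ae (P : Measure (CadlagPath E)) [IsFiniteMeasure P] {C : Set E}
    (hC : IsClosed C) (δ : ℝ≥0) : ∃ T : CadlagPath E → ℝ≥0∞, IsOptional T ∧ (∀ p, δ ≤ T p) ∧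
      (∀ p, T p ≤ hitAfter C (fun _ => δ) p) ∧
      ∀ᵐ p ∂P, T p ≠ ∞ → p.1 (T p).toNNReal ∈ C := by
  set 𝒯 : Set (CadlagPath E → ℝ≥0∞) := {T | IsOptional T ∧ (∀ p, (δ : ℝ≥0∞) ≤ T p) ∧
      ∀ p, T p ≤ hitAfter C (fun _ => (δ : ℝ≥0∞)) p} with h𝒯
  -- The integrand is bounded and strictly decreasing in `T`, including at `∞`; an element of `𝒯`
  -- minimising `J` is thus almost surely as late as possible. The supremum of a minimising sequence
  -- is one.
  set J : (CadlagPath E → ℝ≥0∞) → ℝ≥0∞ := fun T => ∫⁻ p, (1 + T p)⁻¹ ∂P with hJ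
  have hδ : (fun _ => (δ : ℝ≥0∞)) ∈ 𝒯 :=
    ⟨IsOptional.const δ, fun _ => le_rfl, fun p => le_hitAfter _ _ p⟩
  have hJfin (T) : J T ≠ ∞ := by
    refine ne_top_of_le_ne_top (measure_ne_top P univ) ?_
    calc J T ≤ ∫⁻ _, 1 ∂P := lintegral_mono fun p => ENNReal.inv_le_one.2 le_self_add
      _ = P univ := by simp
  set m := ⨅ T ∈ 𝒯, J T with hm
  have hmfin : m ≠ ∞ := ne_top_of_le_ne_top (hJfin _) (iInf₂_le _ hδ)
  have hex (n : ℕ) : ∃ T ∈ 𝒯, J T < m + ((n : ℝ≥0∞) + 1)⁻¹ := by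
    have : m < m + ((n : ℝ≥0∞) + 1)⁻¹ := ENNReal.lt_add_right hmfin (by simp)
    simpa only [hm, iInf_lt_iff, exists_prop] using this
  choose T hT hTm using hex
  have hS : (fun p => ⨆ n, T n p) ∈ 𝒯 :=
    ⟨IsOptional.iSup fun n => (hT n).1, fun p => ((hT 0).2.1 p).trans (le_iSup (fun n => T n p) 0),
      fun p => iSup_le fun n => (hT n).2.2 p⟩
  set S := fun p => ⨆ n, T n p with hSdef
  have hJS : J S ≤ m := by
    have h1 : Tendsto (fun n : ℕ => m + ((n : ℝ≥0∞) + 1)⁻¹) atTop (𝓝 (m + 0)) := by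
      refine tendsto_const_nhds.add ?_
      have := (tendsto_add_atTop_iff_nat 1).2 ENNReal.tendsto_inv_nat_nhds_zero
      simpa using this
    rw [add_zero] at h1
    refine ge_of_tendsto' h1 fun n => le_trans ?_ (hTm n).le
    refine lintegral_mono fun p => ENNReal.inv_le_inv.2 ?_
    gcongr
    exact le_iSup (fun n => T n p) n
  refine ⟨S, hS.1, hS.2.1, hS.2.2, ?_⟩
  -- Waiting after `S` for all thickenings of `C` stays in `𝒯`, so minimality forces `R = S` almost
  -- surely; but `R > S` wherever the path at time `S` is outside `C`.
  set R : CadlagPath E → ℝ≥0∞ :=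
    fun p => ⨆ k : ℕ, hitAfter (Metric.thickening (1 / ((k : ℝ) + 1)) C) S p with hR
  have hSR (p) : S p ≤ R p :=
    (le_hitAfter _ S p).trans (le_iSup (fun k : ℕ => hitAfter (Metric.thickening
      (1 / ((k : ℝ) + 1)) C) S p) 0)
  have hRT : R ∈ 𝒯 := by
    refine ⟨IsOptional.iSup fun k => isOptional_hitAfter Metric.isOpen_thickening hS.1,
      fun p => (hS.2.1 p).trans (hSR p), fun p => iSup_le fun k => le_iInf₂ fun t ht => ?_⟩
    refine hitAfter_le ((hS.2.2 p).trans (hitAfter_le ht.1 ht.2)) ?_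
    exact Metric.self_subset_thickening (by positivity) _ ht.2
  have hae : (fun p => (1 + R p)⁻¹) =ᵐ[P] fun p => (1 + S p)⁻¹ := by
    refine ae_eq_of_ae_le_of_lintegral_le (.of_forall fun p => ?_) (hJfin R)
      (hS.1.measurable.const_add 1).inv.aemeasurable (hJS.trans (iInf₂_le _ hRT))
    refine ENNReal.inv_le_inv.2 ?_
    gcongr
    exact hSR p
  filter_upwards [hae] with p hp hpT
  by_contra hpC
  obtain ⟨k, hk⟩ := exists_lt_hitAfter_thickening hC hpT hpC
  rw [inv_inj, ENNReal.add_right_inj ENNReal.one_ne_top] at hp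
  exact (hk.trans_le (le_iSup (fun k : ℕ => hitAfter (Metric.thickening
      (1 / ((k : ℝ) + 1)) C) S p) k)).ne' hp

end CadlagPath

theorem StrongMarkovFamily.lt_delayedHittingTime_iff {E Ω : Type*} [TopologicalSpace E]
    [MeasurableSpace E] [MeasurableSpace Ω] (M : StrongMarkovFamily E Ω) (C : Set E) (δ s : ℝ≥0)
    (ω : Ω) : (s : WithTop ℝ≥0) < M.delayedHittingTime C δ ω ↔
      (s : ℝ≥0∞) < CadlagPath.hitAfter C (fun _ => δ) (M.path ω) := by
  classical
  rw [delayedHittingTime, hittingAfter_def, CadlagPath.hitAfter]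
  simp only [ENNReal.coe_le_coe, path_apply]
  split_ifs with h
  · have := ENNReal.coe_sInf (s := {i : ℝ≥0 | δ ≤ i ∧ M.X i ω ∈ C}) h
    simp only [mem_ofPred_eq] at this
    rw [← this, ENNReal.coe_lt_coe, WithTop.coe_lt_coe]
  · push Not at h
    have : (⨅ (t : ℝ≥0) (_ : δ ≤ t ∧ M.X t ω ∈ C), (t : ℝ≥0∞)) = ∞ := by
      simp only [iInf_eq_top]
      exact fun t ht => absurd ht.2 (h t ht.1)
    rw [this]
    exact iff_of_true (WithTop.coe_lt_top s) ENNReal.coe_lt_top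

/-! ### Lebesgue measure on the half-line -/

section TimeMeasure

theorem measurableEmbedding_nnreal_coe : MeasurableEmbedding ((↑) : ℝ≥0 → ℝ) :=
  MeasurableEmbedding.subtype_coe measurableSet_Ici

theorem timeMeasure_apply (A : Set ℝ≥0) : timeMeasure A = volume (((↑) : ℝ≥0 → ℝ) '' A) :=
  measurableEmbedding_nnreal_coe.comap_apply _ _

instance : SigmaFinite timeMeasure := by
  have : SigmaFinite (timeMeasure.map ((↑) : ℝ≥0 → ℝ)) := by
    rw [timeMeasure, measurableEmbedding_nnreal_coe.map_comap]
    infer_instance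
  exact SigmaFinite.of_map _ measurableEmbedding_nnreal_coe.measurable.aemeasurable this

theorem timeMeasure_Iio (a : ℝ≥0) : timeMeasure (Iio a) = a := by
  have : ((↑) : ℝ≥0 → ℝ) '' Iio a = Ico 0 (a : ℝ) := by
    ext x
    constructor
    · rintro ⟨y, hy, rfl⟩
      exact ⟨y.2, by exact_mod_cast hy⟩
    · rintro ⟨h0, h1⟩
      lift x to ℝ≥0 using h0
      exact ⟨x, by exact_mod_cast h1, rfl⟩
  rw [timeMeasure_apply, this]
  simp

theorem map_add_timeMeasure (a : ℝ≥0) :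
    timeMeasure.map (fun u => a + u) = timeMeasure.restrict (Ici a) := by
  ext A hA
  rw [Measure.map_apply (by fun_prop) hA, Measure.restrict_apply hA, timeMeasure_apply,
    timeMeasure_apply]
  have : ((↑) : ℝ≥0 → ℝ) '' (A ∩ Ici a) =
      (fun x => (a : ℝ) + x) '' (((↑) : ℝ≥0 → ℝ) '' ((fun u => a + u) ⁻¹' A)) := by
    ext x
    simp only [mem_image, mem_preimage, mem_inter_iff, mem_Ici, exists_exists_and_eq_and]
    constructor
    · rintro ⟨y, ⟨hy, hay⟩, rfl⟩
      exact ⟨y - a, by rwa [add_tsub_cancel_of_le hay], by rw [NNReal.coe_sub hay]; ring⟩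
    · rintro ⟨y, hy, rfl⟩
      exact ⟨a + y, ⟨hy, le_self_add⟩, by push_cast; rfl⟩
  rw [this, image_add_left, measure_preimage_add]

theorem lintegral_add_timeMeasure (a : ℝ≥0) {g : ℝ≥0 → ℝ≥0∞} (hg : Measurable g) :
    ∫⁻ u, g (a + u) ∂timeMeasure = ∫⁻ u in Ici a, g u ∂timeMeasure := by
  rw [← map_add_timeMeasure, lintegral_map hg (by fun_prop)]

instance : NeZero timeMeasure := ⟨fun h => by
  have := timeMeasure_Iio 1
  simp [h] at this⟩

end TimeMeasure

/-! ### Growth of subgeometric rates -/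

namespace IsSubgeometricRate₀

variable {r : ℝ≥0 → ℝ≥0} (h : IsSubgeometricRate₀ r)
include h

theorem one_lt (t : ℝ≥0) : (1 : ℝ) < r t := by
  have : (2 : ℝ) ≤ r t := by exact_mod_cast h.2.2.1 t
  linarith

theorem log_add_le {s : ℝ≥0} (hs : 0 < s) (t : ℝ≥0) :
    Real.log (r (s + t)) ≤ Real.log (r s) + t * (Real.log (r s) / s) := by
  have h1 := h.2.2.2.1 (mem_Ioi.2 hs) (mem_Ioi.2 (add_pos_of_pos_of_nonneg hs (zero_le : 0 ≤ t)))
    (le_self_add : s ≤ s + t)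
  simp only at h1
  have hs' : (0 : ℝ) < s := by exact_mod_cast hs
  have ht' : (0 : ℝ) ≤ t := t.2
  rw [div_le_iff₀ (by push_cast; positivity)] at h1
  refine h1.trans (le_of_eq ?_)
  push_cast
  field_simp

/-- Since `log r(t) / t` is nonincreasing, `log r` is subadditive on positive times; when an
argument vanishes, `r ≥ 2` suffices. -/
theorem add_le_mul (s t : ℝ≥0) : r (s + t) ≤ r s * r t := by
  rcases eq_or_lt_of_le (zero_le : 0 ≤ s) with rfl | hs
  · rw [zero_add]
    exact le_mul_of_one_le_left zero_le (one_le_two.trans (h.2.2.1 0))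
  rcases eq_or_lt_of_le (zero_le : 0 ≤ t) with rfl | ht
  · rw [add_zero]
    exact le_mul_of_one_le_right zero_le (one_le_two.trans (h.2.2.1 0))
  have hs' : (0 : ℝ) < s := by exact_mod_cast hs
  have ht' : (0 : ℝ) < t := by exact_mod_cast ht
  have h0 (u : ℝ≥0) : (0 : ℝ) < r u := zero_lt_one.trans (h.one_lt u)
  have h1 := h.2.2.2.1 (mem_Ioi.2 hs) (mem_Ioi.2 (add_pos hs ht)) (le_self_add : s ≤ s + t)
  have h2 := h.2.2.2.1 (mem_Ioi.2 ht) (mem_Ioi.2 (add_pos hs ht)) (le_add_self : t ≤ s + t)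
  simp only at h1 h2
  rw [le_div_iff₀ hs'] at h1
  rw [le_div_iff₀ ht'] at h2
  rw [← NNReal.coe_le_coe, NNReal.coe_mul, ← Real.log_le_log_iff (h0 _) (mul_pos (h0 _) (h0 _)),
    Real.log_mul (h0 _).ne' (h0 _).ne']
  refine le_trans (le_of_eq ?_) (add_le_add h1 h2)
  push_cast
  field_simp

theorem exists_add_one_le {ε : ℝ≥0} (hε : 0 < ε) :
    ∃ s₀ : ℝ≥0, ∀ s ≥ s₀, r (s + 1) ≤ (1 + ε) * r s := by
  have hε' : (0 : ℝ) < ε := by exact_mod_cast hε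
  have h1 : ∀ᶠ s : ℝ≥0 in atTop, Real.log (r s) / s < Real.log (1 + ε) :=
    h.2.2.2.2.eventually (gt_mem_nhds (Real.log_pos (by linarith)))
  obtain ⟨s₀, hs₀⟩ := eventually_atTop.1 (h1.and (eventually_gt_atTop 0))
  refine ⟨s₀, fun s hs => ?_⟩
  have h0 (u : ℝ≥0) : (0 : ℝ) < r u := zero_lt_one.trans (h.one_lt u)
  have h2 := h.log_add_le (hs₀ s hs).2 1
  rw [← NNReal.coe_le_coe, ← Real.log_le_log_iff (h0 _)
    (by push_cast; exact mul_pos (by positivity) (h0 _))]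
  push_cast
  rw [Real.log_mul (by positivity) (h0 _).ne']
  have h3 := (hs₀ s hs).1
  simp only [NNReal.coe_one, one_mul] at h2
  linarith

/-- Far from the origin, a subgeometric rate grows slowly with respect to its own integral. -/
theorem exists_add_le {ε : ℝ≥0} (hε : 0 < ε) : ∃ s₀ : ℝ≥0, ∀ s ≥ s₀, ∀ t : ℝ≥0,
    (r (s + t) : ℝ≥0∞) ≤ r s * (1 + ε * (1 + ∫⁻ u in Iio t, r u ∂timeMeasure)) := by
  obtain ⟨s₀, hs₀⟩ := h.exists_add_one_le hε
  refine ⟨s₀, fun s hs t => ?_⟩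
  obtain ⟨n, hn⟩ := exists_nat_gt t
  induction n generalizing t with
  | zero => simp at hn
  | succ n ih =>
    rcases lt_or_ge t 1 with ht | ht
    · calc (r (s + t) : ℝ≥0∞) ≤ (((1 + ε) * r s : ℝ≥0) : ℝ≥0∞) := by
            exact_mod_cast (h.2.1 (by gcongr)).trans (hs₀ s hs)
        _ = r s * (1 + ε * (1 + 0)) := by push_cast; ring
        _ ≤ _ := by gcongr; exact zero_le
    · obtain ⟨t, rfl⟩ : ∃ u, t = u + 1 := ⟨t - 1, (tsub_add_cancel_of_le ht).symm⟩
      have ht' : t < n := by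
        push_cast at hn
        exact lt_of_add_lt_add_right hn
      -- The increment over the last unit of time is at most `ε * r (s + t) ≤ ε * r s * r t`, and
      -- monotonicity bounds `r t` by the integral over `[t, t + 1)`: the increments sum to the
      -- integral up to the end.
      have h1 := ih t ht'
      have h2 : (r t : ℝ≥0∞) ≤ ∫⁻ u in Ico t (t + 1), r u ∂timeMeasure := by
        calc (r t : ℝ≥0∞) = ∫⁻ _ in Ico t (t + 1), r t ∂timeMeasure := by
              have : timeMeasure (Ico t (t + 1)) = 1 := by
                have e : Ico t (t + 1) = Iio (t + 1) \ Iio t := by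
                  ext; simp
                rw [e, measure_sdiff (Iio_subset_Iio le_self_add)
                  measurableSet_Iio.nullMeasurableSet (by rw [timeMeasure_Iio]; simp),
                  timeMeasure_Iio, timeMeasure_Iio]
                push_cast
                exact ENNReal.add_sub_cancel_left ENNReal.coe_ne_top
              rw [setLIntegral_const, this, mul_one]
          _ ≤ _ := setLIntegral_mono (h.1.coe_nnreal_ennreal) fun u hu => by
              exact_mod_cast h.2.1 hu.1
      have h3 : ∫⁻ u in Iio (t + 1), r u ∂timeMeasure =
          (∫⁻ u in Iio t, r u ∂timeMeasure) + ∫⁻ u in Ico t (t + 1), r u ∂timeMeasure := by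
        rw [← lintegral_union measurableSet_Ico]
        · congr 2
          exact (Iio_union_Ico_eq_Iio le_self_add).symm
        · exact (Iio_disjoint_Ici le_rfl).mono_right Ico_subset_Ici_self
      calc (r (s + (t + 1)) : ℝ≥0∞) ≤ (((1 + ε) * r (s + t) : ℝ≥0) : ℝ≥0∞) := by
            rw [← add_assoc]
            exact_mod_cast hs₀ (s + t) (hs.trans le_self_add)
        _ = r (s + t) + ε * r (s + t) := by push_cast; ring
        _ ≤ r s * (1 + ε * (1 + ∫⁻ u in Iio t, r u ∂timeMeasure)) + ε * (r s * r t) := by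
            gcongr
            exact_mod_cast h.add_le_mul s t
        _ ≤ r s * (1 + ε * (1 + ∫⁻ u in Iio t, r u ∂timeMeasure)) +
            ε * (r s * ∫⁻ u in Ico t (t + 1), r u ∂timeMeasure) := by gcongr
        _ = _ := by rw [h3]; ring

end IsSubgeometricRate₀

/-- A locally bounded subgeometric rate is comparable on all of `[0, ∞)` to a regular one. -/
theorem IsSubgeometricRate.exists_le_le {r : ℝ≥0 → ℝ≥0} (hr : IsSubgeometricRate r)
    (hr_loc : ∀ T : ℝ≥0, ∃ c K : ℝ≥0, 0 < c ∧ ∀ t ≤ T, c ≤ r t ∧ r t ≤ K) :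
    ∃ r₀, IsSubgeometricRate₀ r₀ ∧ ∃ c : ℝ≥0, (∀ t, r₀ t ≤ c * r t) ∧ ∀ t, r t ≤ c * r₀ t := by
  obtain ⟨-, hpos, r₀, h₀, hinf, hsup⟩ := hr
  refine ⟨r₀, h₀, ?_⟩
  have hr₀ (t) : 0 < r₀ t := zero_lt_two.trans_le (h₀.2.2.1 t)
  obtain ⟨a, ha0, ha⟩ := exists_between hinf
  obtain ⟨b, hb, hbt⟩ := exists_between hsup
  lift b to ℝ≥0 using hbt.ne
  lift a to ℝ≥0 using (ha.trans_le (liminf_le_limsup (by isBoundedDefault)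
    (by isBoundedDefault)) |>.trans hsup).ne
  have ha0' : 0 < a := by exact_mod_cast ha0
  obtain ⟨T, hT⟩ := eventually_atTop.1 ((eventually_lt_of_lt_liminf ha).and
    (eventually_lt_of_limsup_lt hb))
  obtain ⟨c, K, hc, hcK⟩ := hr_loc T
  -- `a⁻¹` and `b` serve beyond `T`, `r₀ T / c` and `K` up to `T`; `K` is enough there because `r₀ ≥
  -- 1`.
  refine ⟨max (max a⁻¹ b) (max (r₀ T / c) K), fun t => ?_, fun t => ?_⟩
  · rcases le_total t T with h | h
    · calc r₀ t ≤ r₀ T := h₀.2.1 h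
        _ = r₀ T / c * c := by field_simp
        _ ≤ _ := mul_le_mul' ((le_max_left _ _).trans (le_max_right _ _)) (hcK t h).1
    · have h1 : a < r t / r₀ t := by exact_mod_cast (hT t h).1
      rw [lt_div_iff₀ (hr₀ t)] at h1
      calc r₀ t = a⁻¹ * (a * r₀ t) := by field_simp
        _ ≤ _ := mul_le_mul' ((le_max_left _ _).trans (le_max_left _ _)) h1.le
  · rcases le_total t T with h | h
    · calc r t ≤ K * 1 := by rw [mul_one]; exact (hcK t h).2
        _ ≤ _ := mul_le_mul' ((le_max_right _ _).trans (le_max_right _ _))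
          (one_le_two.trans (h₀.2.2.1 t))
    · have h1 : r t / r₀ t < b := by exact_mod_cast (hT t h).2
      rw [div_lt_iff₀ (hr₀ t)] at h1
      exact h1.le.trans (mul_le_mul' ((le_max_right _ _).trans (le_max_left _ _)) le_rfl)

/-- The finite measure `ψ.toFinite` has the same null sets as `ψ`, and it is inner regular for
closed sets. -/
theorem exists_isClosed_subset_measure_pos {E : Type*} [TopologicalSpace E]
    [TopologicalSpace.PseudoMetrizableSpace E] [MeasurableSpace E] [BorelSpace E]
    (ψ : Measure E) [SigmaFinite ψ] {A : Set E}
    (hA : MeasurableSet A) (h : 0 < ψ A) : ∃ F ⊆ A, IsClosed F ∧ 0 < ψ F := by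
  have h1 : 0 < ψ.toFinite A := by
    rw [pos_iff_ne_zero, ne_eq, toFinite_apply_eq_zero_iff]
    exact h.ne'
  rw [hA.measure_eq_iSup_isClosed_of_ne_top (measure_ne_top _ _)] at h1
  simp only [lt_iSup_iff, exists_prop] at h1
  obtain ⟨F, hF, hFc, hFpos⟩ := h1
  refine ⟨F, hF, hFc, ?_⟩
  rwa [pos_iff_ne_zero, ne_eq, toFinite_apply_eq_zero_iff, ← ne_eq, ← pos_iff_ne_zero] at hFpos

/-! ### Occupation times -/

section Occupation

variable {E : Type*} [TopologicalSpace E]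

/-- The time spent in `B` during `[t, u)`. -/
noncomputable def CadlagPath.occupation (B : Set E) (t u : ℝ≥0) (p : CadlagPath E) : ℝ≥0∞ :=
  timeMeasure ({v | p.1 v ∈ B} ∩ Ico t u)

namespace CadlagPath

theorem occupation_mono (B : Set E) {t t' u u' : ℝ≥0} (ht : t' ≤ t) (hu : u ≤ u')
    (p : CadlagPath E) : occupation B t u p ≤ occupation B t' u' p := by
  unfold occupation
  gcongr

variable [TopologicalSpace.PseudoMetrizableSpace E] [MeasurableSpace E] [BorelSpace E] {B : Set E}

theorem measurableSet_times (hB : MeasurableSet B) (p : CadlagPath E) :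
    MeasurableSet {v | p.1 v ∈ B} :=
  measurable_id.cadlagPath_eval measurable_const hB

theorem occupation_shift (hB : MeasurableSet B) (s t u : ℝ≥0) (p : CadlagPath E) :
    occupation B t u (shift s p) = occupation B (s + t) (s + u) p := by
  have hS := (measurableSet_times hB p).inter (measurableSet_Ico (a := s + t) (b := s + u))
  have h := congrArg (fun ν => ν ({v | p.1 v ∈ B} ∩ Ico (s + t) (s + u))) (map_add_timeMeasure s)
  rw [Measure.map_apply (by fun_prop) hS, Measure.restrict_apply hS] at h
  unfold occupation
  convert h using 2
  · ext v; simp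
  · rw [left_eq_inter]
    exact fun v hv => le_self_add.trans hv.2.1

theorem measurable_occupation (hB : MeasurableSet B) (t : ℝ≥0) {α : Type*} [MeasurableSpace α]
    {S : α → ℝ≥0} {g : α → CadlagPath E} (hS : Measurable S) (hg : Measurable g) :
    Measurable fun a => occupation B t (S a) (g a) := by
  have h1 : MeasurableSet {q : α × ℝ≥0 | t ≤ q.2} :=
    measurableSet_le measurable_const measurable_snd
  have h2 : MeasurableSet {q : α × ℝ≥0 | q.2 < S q.1} :=
    measurableSet_lt measurable_snd (hS.comp measurable_fst)
  have h : MeasurableSet {q : α × ℝ≥0 | (g q.1).1 q.2 ∈ B ∧ t ≤ q.2 ∧ q.2 < S q.1} :=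
    ((measurable_snd.cadlagPath_eval (hg.comp measurable_fst)) hB).inter (h1.inter h2)
  exact measurable_measure_prodMk_left h

theorem measurable_past_occupation (hB : MeasurableSet B) (t u : ℝ≥0) :
    Measurable[past E u] (occupation B t u) := by
  have h : MeasurableSet[@Prod.instMeasurableSpace _ _ (past E u) inferInstance]
      {q : CadlagPath E × ℝ≥0 | q.1.1 q.2 ∈ B ∧ t ≤ q.2 ∧ q.2 < u} := by
    let _ : MeasurableSpace (CadlagPath E) := past E u
    have h1 := measurableSet_eval_of_rightContinuous
      (fun s (q : CadlagPath E × ℝ≥0) => q.1.1 s) u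
      (fun s hs => (measurable_past_eval hs).comp measurable_fst) (fun q s => q.1.2.1 s)
      (fun q => (q.2 : ℝ≥0∞)) (fun v _ => measurableSet_lt (by fun_prop) measurable_const) hB
    convert h1.inter (measurableSet_le measurable_const measurable_snd :
      MeasurableSet {q : CadlagPath E × ℝ≥0 | t ≤ q.2}) using 1
    ext q
    simp only [mem_ofPred_eq, mem_inter_iff, ENNReal.coe_lt_coe, ENNReal.toNNReal_coe]
    tauto
  exact @measurable_measure_prodMk_left _ _ (past E u) _ _ _ _ h

end CadlagPath

end Occupation

/-! ### Resolvent and maximal irreducibility measures -/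

namespace StrongMarkovFamily

open CadlagPath

variable {E Ω : Type*} [TopologicalSpace E] [TopologicalSpace.PseudoMetrizableSpace E]
  [MeasurableSpace E] [BorelSpace E] [MeasurableSpace Ω] (M : StrongMarkovFamily E Ω)

/-- The law of the process at an independent random time of law `a`. -/
noncomputable def sampled (a : Measure ℝ≥0) : Kernel E E :=
  (M.pathLaw ×ₖ Kernel.const E a).map fun q => q.1.1 q.2

theorem measurable_eval_swap : Measurable fun q : CadlagPath E × ℝ≥0 => q.1.1 q.2 :=
  measurable_snd.cadlagPath_eval measurable_fst

variable {M}

instance (a : Measure ℝ≥0) [IsProbabilityMeasure a] : IsMarkovKernel (M.sampled a) :=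
  Kernel.IsMarkovKernel.map _ measurable_eval_swap

theorem lintegral_sampled (a : Measure ℝ≥0) [SFinite a] (x : E) {g : E → ℝ≥0∞}
    (hg : Measurable g) :
    ∫⁻ y, g y ∂M.sampled a x = ∫⁻ u, ∫⁻ p, g (p.1 u) ∂M.pathLaw x ∂a := by
  have h : Measurable fun q : CadlagPath E × ℝ≥0 => g (q.1.1 q.2) := hg.comp measurable_eval_swap
  rw [sampled, Kernel.map_apply _ measurable_eval_swap, lintegral_map hg measurable_eval_swap,
    Kernel.prod_apply, Kernel.const_apply, lintegral_prod_symm' _ h]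

theorem sampled_apply (a : Measure ℝ≥0) [SFinite a] (x : E) {A : Set E} (hA : MeasurableSet A) :
    M.sampled a x A = ∫⁻ u, M.trans u x A ∂a := by
  rw [← lintegral_indicator_one hA, lintegral_sampled a x (measurable_one.indicator hA)]
  refine lintegral_congr fun u => ?_
  rw [← M.pathLaw_eval u x hA]
  exact lintegral_indicator_one (measurable_eval u hA)

theorem sampled_apply' (a : Measure ℝ≥0) [SFinite a] (x : E) {A : Set E} (hA : MeasurableSet A) :
    M.sampled a x A = ∫⁻ p, a {u | p.1 u ∈ A} ∂M.pathLaw x := by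
  rw [sampled, Kernel.map_apply' _ measurable_eval_swap _ hA, Kernel.prod_apply,
    Measure.prod_apply (measurable_eval_swap hA)]
  rfl

theorem trans_add (u v : ℝ≥0) (x : E) {A : Set E} (hA : MeasurableSet A) :
    M.trans (u + v) x A = ∫⁻ p, M.trans v (p.1 u) A ∂M.pathLaw x := by
  have h := M.lintegral_shift_const x u
    (G := {q : CadlagPath E | q.1 v ∈ A}.indicator 1)
    (measurable_one.indicator (measurable_eval v hA))
  have e (y : E) : ∫⁻ q, {q : CadlagPath E | q.1 v ∈ A}.indicator 1 q ∂M.pathLaw y =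
      M.trans v y A := by
    rw [← M.pathLaw_eval v y hA]
    exact lintegral_indicator_one (measurable_eval v hA)
  simp only [e] at h
  rw [← h, ← M.pathLaw_eval (u + v) x hA]
  exact (lintegral_indicator_one (measurable_eval (u + v) hA)).symm

theorem measurable_trans_time (x : E) {A : Set E} (hA : MeasurableSet A) :
    Measurable fun u => M.trans u x A := by
  simp only [← M.pathLaw_eval _ x hA]
  exact measurable_measure_prodMk_right (measurable_eval_swap hA)

/-- Chapman–Kolmogorov averaged over two independent times. It shows that two resolvent steps are
again a sampling of the process, as petiteness demands. -/
theorem lintegral_sampled_sampled (a b : Measure ℝ≥0) [IsProbabilityMeasure a]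
    [IsProbabilityMeasure b] (x : E) {A : Set E} (hA : MeasurableSet A) :
    ∫⁻ y, M.sampled b y A ∂M.sampled a x =
      ∫⁻ t, M.trans t x A ∂(a.prod b).map fun q => q.1 + q.2 := by
  have hm : Measurable fun q : ℝ≥0 × ℝ≥0 => M.trans (q.1 + q.2) x A :=
    (measurable_trans_time x hA).comp (measurable_fst.add measurable_snd)
  rw [lintegral_sampled a x ((M.sampled b).measurable_coe hA),
    lintegral_map (measurable_trans_time x hA) (by fun_prop),
    lintegral_prod _ hm.aemeasurable]
  refine lintegral_congr fun u => ?_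
  simp only [sampled_apply b _ hA, trans_add u _ x hA]
  rw [lintegral_lintegral_swap]
  have h : Measurable fun q : CadlagPath E × ℝ≥0 => M.pathLaw (q.1.1 u) {p | p.1 q.2 ∈ A} :=
    Kernel.measurable_kernel_prodMk_left (κ := M.pathLaw.comap
      (fun q : CadlagPath E × ℝ≥0 => q.1.1 u) ((measurable_eval u).comp measurable_fst))
      (t := {z : (CadlagPath E × ℝ≥0) × CadlagPath E | z.2.1 z.1.2 ∈ A}) (by
        exact (measurable_fst.snd.cadlagPath_eval measurable_snd) hA)
  simp only [M.pathLaw_eval _ _ hA] at h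
  exact h.aemeasurable

variable (M) in
/-- The law of the process at an independent random time with positive density. -/
noncomputable def resolvent : Kernel E E := M.sampled timeMeasure.toFinite

instance : IsMarkovKernel M.resolvent := by unfold resolvent; infer_instance

theorem measurable_measure_times (a : Measure ℝ≥0) [SFinite a] {A : Set E}
    (hA : MeasurableSet A) : Measurable fun p : CadlagPath E => a {u | p.1 u ∈ A} :=
  measurable_measure_prodMk_left (measurable_eval_swap hA)

theorem resolvent_eq_zero_iff (x : E) {A : Set E} (hA : MeasurableSet A) :
    M.resolvent x A = 0 ↔ ∀ᵐ p ∂M.pathLaw x, timeMeasure {u | p.1 u ∈ A} = 0 := by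
  rw [resolvent, sampled_apply' _ x hA, lintegral_eq_zero_iff
    (measurable_measure_times _ hA)]
  simp only [EventuallyEq, Pi.zero_apply, toFinite_apply_eq_zero_iff]

theorem occupation_pos_iff (x : E) {A : Set E} (hA : MeasurableSet A) :
    0 < ∫⁻ ω, ∫⁻ s, A.indicator (1 : E → ℝ≥0∞) (M.X s ω) ∂timeMeasure ∂M.law x ↔
      M.resolvent x A ≠ 0 := by
  have h1 : ∫⁻ ω, ∫⁻ s, A.indicator (1 : E → ℝ≥0∞) (M.X s ω) ∂timeMeasure ∂M.law x =
      ∫⁻ p, timeMeasure {u | p.1 u ∈ A} ∂M.pathLaw x := by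
    rw [pathLaw_apply, lintegral_map (measurable_measure_times _ hA) M.measurable_path]
    refine lintegral_congr fun ω => ?_
    exact lintegral_indicator_one (measurableSet_times hA (M.path ω))
  rw [h1, pos_iff_ne_zero, ne_eq, ne_eq, resolvent_eq_zero_iff x hA,
    lintegral_eq_zero_iff (measurable_measure_times _ hA)]
  rfl

/-- The resolvent samples at a time whose law has the null sets of Lebesgue measure, so it charges
exactly the sets with positive expected occupation time. -/
theorem isIrreducibilityMeasure_iff {φ : Measure E} : M.IsIrreducibilityMeasure φ ↔
    SigmaFinite φ ∧ φ ≠ 0 ∧ ∀ x, φ ≪ M.resolvent x := by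
  refine and_congr_right fun _ => and_congr_right fun _ => ⟨fun h x => ?_, fun h A hA hφ x => ?_⟩
  · refine Measure.AbsolutelyContinuous.mk fun A hA h0 => ?_
    by_contra hφ
    exact (occupation_pos_iff x hA).1 (h A hA (pos_iff_ne_zero.2 hφ) x) h0
  · exact (occupation_pos_iff x hA).2 fun h0 => hφ.ne' (h x h0)

/-- A path that spends no time in `A` spends none in `A` after time `u` either; the Markov property
at `u` turns this into a statement about the state at `u`. -/
theorem resolvent_eq_zero_ae {x : E} {A : Set E} (hA : MeasurableSet A)
    (h : M.resolvent x A = 0) : ∀ᵐ y ∂M.resolvent x, M.resolvent y A = 0 := by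
  have hm := M.resolvent.measurable_coe hA
  refine (lintegral_eq_zero_iff hm).1 ?_
  refine (lintegral_sampled _ x hm).trans ?_
  refine lintegral_eq_zero_of_ae_eq_zero (.of_forall fun u => ?_)
  have h1 := M.lintegral_shift_const x u (measurable_measure_times timeMeasure.toFinite hA)
  simp only [Pi.zero_apply, resolvent, sampled_apply' _ _ hA]
  rw [← h1]
  refine lintegral_eq_zero_of_ae_eq_zero ?_
  filter_upwards [(resolvent_eq_zero_iff x hA).1 h] with p hp
  rw [Pi.zero_apply, toFinite_apply_eq_zero_iff]
  have h2 := congrArg (fun ν => ν {v | p.1 v ∈ A}) (map_add_timeMeasure u)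
  rw [Measure.map_apply (by fun_prop) (measurableSet_times hA p)] at h2
  refine h2.trans (le_antisymm ?_ zero_le)
  exact (Measure.restrict_apply_le _ _).trans hp.le

/-- Smearing `φ` by the resolvent gives the maximal measure. It stays an irreducibility measure
because resolvent-null sets are inherited along the process; and a set it ignores is resolvent-null
from some point, hence null for every irreducibility measure. -/
theorem IsIrreducible.exists_maximal (hM : M.IsIrreducible) :
    ∃ ψ, M.IsMaximalIrreducibilityMeasure ψ := by
  obtain ⟨φ, hφ⟩ := hM
  obtain ⟨_, hφ0, hφK⟩ := isIrreducibilityMeasure_iff.1 hφ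
  have : NeZero φ := ⟨hφ0⟩
  have hbind {A : Set E} (hA : MeasurableSet A) :
      φ.toFinite.bind M.resolvent A = 0 ↔ ∀ᵐ y ∂φ, M.resolvent y A = 0 := by
    rw [Measure.bind_apply hA M.resolvent.aemeasurable,
      lintegral_eq_zero_iff (M.resolvent.measurable_coe hA), ae_toFinite]
    rfl
  refine ⟨φ.toFinite.bind M.resolvent, isIrreducibilityMeasure_iff.2 ⟨inferInstance, ?_, ?_⟩, ?_⟩
  · exact IsProbabilityMeasure.ne_zero _
  · intro x
    refine Measure.AbsolutelyContinuous.mk fun A hA h0 => (hbind hA).2 ?_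
    exact (hφK x).ae_le (resolvent_eq_zero_ae hA h0)
  · intro φ' hφ'
    refine Measure.AbsolutelyContinuous.mk fun A hA h0 => ?_
    obtain ⟨y, hy⟩ := ((hbind hA).1 h0).exists
    exact (isIrreducibilityMeasure_iff.1 hφ').2.2 y hy

theorem IsAccessible.resolvent_ne_zero {B : Set E} (hB : M.IsAccessible B) (x : E) :
    M.resolvent x B ≠ 0 := by
  obtain ⟨-, ψ, hψ, hψB⟩ := hB
  exact fun h => hψB.ne' ((isIrreducibilityMeasure_iff.1 hψ.1).2.2 x h)

end StrongMarkovFamily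

/-! ### Petite sets -/

theorem one_half_le_measure_inter {α : Type*} [MeasurableSpace α] (φ : Measure α)
    [IsProbabilityMeasure φ] {A B : Set α} (hB : MeasurableSet B)
    (h1 : 3 / 4 < φ A) (h2 : 3 / 4 < φ B) : 1 / 2 ≤ φ (A ∩ B) := by
  by_contra! h
  have h3 := measure_union_add_inter (μ := φ) A hB
  have h4 : φ (A ∪ B) ≤ 1 := prob_le_one
  have h5 : φ A + φ B < 1 + 1 / 2 := by
    rw [← h3]
    exact ENNReal.add_lt_add_of_le_of_lt (measure_ne_top _ _) h4 h
  have h6 : (3 / 4 + 3 / 4 : ℝ≥0∞) < φ A + φ B := ENNReal.add_lt_add h1 h2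
  have h7 : (3 / 4 + 3 / 4 : ℝ≥0∞) = 1 + 1 / 2 := by
    have : (3 / 4 : ℝ≥0∞) = ((3 / 4 : ℝ≥0) : ℝ≥0∞) := by
      rw [ENNReal.coe_div (by norm_num)]; norm_num
    have h' : (1 / 2 : ℝ≥0∞) = ((1 / 2 : ℝ≥0) : ℝ≥0∞) := by
      rw [ENNReal.coe_div (by norm_num)]; norm_num
    rw [this, h', ← ENNReal.coe_one, ← ENNReal.coe_add, ← ENNReal.coe_add]
    norm_num
  rw [h7] at h6
  exact lt_irrefl _ (h5.trans h6)

theorem exists_measure_level_gt {α : Type*} [MeasurableSpace α] (φ : Measure α)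
    [IsProbabilityMeasure φ] {g : α → ℝ≥0∞} (hpos : ∀ᵐ y ∂φ, 0 < g y) :
    ∃ n : ℕ, 3 / 4 < φ {y | ((n : ℝ≥0∞) + 1)⁻¹ ≤ g y} := by
  have hmono : Monotone fun n : ℕ => {y | ((n : ℝ≥0∞) + 1)⁻¹ ≤ g y} := by
    intro n m hnm y hy
    refine le_trans (ENNReal.inv_le_inv.2 ?_) hy
    gcongr
  have h1 := tendsto_measure_iUnion_atTop (μ := φ) hmono
  have h2 : φ (⋃ n : ℕ, {y | ((n : ℝ≥0∞) + 1)⁻¹ ≤ g y}) = 1 := by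
    rw [← measure_univ (μ := φ)]
    refine measure_congr ?_
    filter_upwards [hpos] with y hy
    refine propext (iff_of_true ?_ trivial)
    obtain ⟨n, hn⟩ := ENNReal.exists_inv_nat_lt hy.ne'
    refine mem_iUnion.2 ⟨n, le_trans (ENNReal.inv_le_inv.2 le_self_add) hn.le⟩
  rw [h2] at h1
  have h3 : (3 / 4 : ℝ≥0∞) < 1 := by
    rw [ENNReal.div_lt_iff (by simp) (by simp), one_mul]
    norm_num
  exact (h1.eventually (lt_mem_nhds h3)).exists

namespace StrongMarkovFamily

open CadlagPath

variable {E Ω : Type*} [TopologicalSpace E] [TopologicalSpace.PseudoMetrizableSpace E]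
  [MeasurableSpace E] [BorelSpace E] [MeasurableSpace Ω] {M : StrongMarkovFamily E Ω}

/-- Every set that is charged by a maximal irreducibility measure contains a closed petite set with
the same property. -/
theorem IsMaximalIrreducibilityMeasure.exists_isPetite [SecondCountableTopology E]
    {ψ : Measure E} (hψ : M.IsMaximalIrreducibilityMeasure ψ) {C : Set E} (hC : MeasurableSet C)
    (hψC : 0 < ψ C) : ∃ C' ⊆ C, IsClosed C' ∧ 0 < ψ C' ∧ M.IsPetite C' := by
  obtain ⟨hσ, hψ0, hψK⟩ := isIrreducibilityMeasure_iff.1 hψ.1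
  have : NeZero ψ := ⟨hψ0⟩
  set φ := ψ.toFinite with hφ
  set d : E → E → ℝ≥0∞ := Kernel.rnDeriv M.resolvent (Kernel.const E φ) with hd
  have hdm : Measurable fun q : E × E => d q.1 q.2 := Kernel.measurable_rnDeriv _ _
  have hdeq (x : E) : d x =ᵐ[φ] (M.resolvent x).rnDeriv φ :=
    Kernel.rnDeriv_eq_rnDeriv_measure (κ := M.resolvent) (η := Kernel.const E φ) (a := x)
  have hpos (x : E) : ∀ᵐ y ∂φ, 0 < d x y := by
    filter_upwards [hdeq x, Measure.rnDeriv_pos'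
      ((toFinite_absolutelyContinuous ψ).trans (hψK x))] with y hy hy'
    rwa [hy]
  have hle (x : E) {g : E → ℝ≥0∞} (hg : Measurable g) :
      ∫⁻ y, d x y * g y ∂φ ≤ ∫⁻ y, g y ∂M.resolvent x := by
    calc ∫⁻ y, d x y * g y ∂φ = ∫⁻ y, ((M.resolvent x).rnDeriv φ * g) y ∂φ :=
          lintegral_congr_ae ((hdeq x).mul (ae_eq_refl g))
      _ = ∫⁻ y, g y ∂φ.withDensity ((M.resolvent x).rnDeriv φ) :=
          (lintegral_withDensity_eq_lintegral_mul _ (Measure.measurable_rnDeriv _ _) hg).symm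
      _ ≤ _ := lintegral_mono' (Measure.withDensity_rnDeriv_le _ _) le_rfl
  have hlevel (n : ℕ) : MeasurableSet {q : E × E | ((n : ℝ≥0∞) + 1)⁻¹ ≤ d q.1 q.2} :=
    measurableSet_le measurable_const hdm
  -- For `x` in `S n` and `z` in `R m`, the sets of intermediate points `y` with `d x y` and `d y z`
  -- bounded below overlap in mass at least 1/2. The two-step density is then bounded below on `S n
  -- ×ˢ R m`.
  set S : ℕ → Set E := fun n => {x ∈ C | 3 / 4 < φ {y | ((n : ℝ≥0∞) + 1)⁻¹ ≤ d x y}} with hS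
  have hSm (n) : MeasurableSet (S n) :=
    hC.inter (measurableSet_lt measurable_const (measurable_measure_prodMk_left (hlevel n)))
  obtain ⟨n, hn⟩ : ∃ n, 0 < ψ (S n) := by
    by_contra! h
    have h1 : ψ (⋃ n, S n) = 0 := measure_iUnion_null fun n => le_antisymm (h n) zero_le
    refine hψC.ne' (measure_mono_null (fun x hx => ?_) h1)
    obtain ⟨n, hn⟩ := exists_measure_level_gt φ (hpos x)
    exact mem_iUnion.2 ⟨n, hx, hn⟩
  set R : ℕ → Set E := fun m => {z | 3 / 4 < φ {y | ((m : ℝ≥0∞) + 1)⁻¹ ≤ d y z}} with hR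
  have hRm (m) : MeasurableSet (R m) :=
    measurableSet_lt measurable_const (measurable_measure_prodMk_right (hlevel m))
  -- Positivity is known for almost every endpoint from each start; Fubini exchanges the roles of
  -- the two variables.
  have hpos' : ∀ᵐ z ∂φ, ∀ᵐ y ∂φ, 0 < d y z :=
    (Measure.ae_ae_comm (p := fun y z => 0 < d y z) (μ := φ) (ν := φ)
      (measurableSet_lt measurable_const hdm)).1 (.of_forall hpos)
  obtain ⟨m, hm⟩ : ∃ m, φ (R m) ≠ 0 := by
    by_contra! h
    have h1 : φ (⋃ m, R m) = 0 := measure_iUnion_null h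
    have h2 : ∀ᵐ z ∂φ, z ∉ ⋃ m, R m := measure_eq_zero_iff_ae_notMem.1 h1
    obtain ⟨z, hz, hz'⟩ := (hpos'.and h2).exists
    obtain ⟨m, hm⟩ := exists_measure_level_gt φ hz
    exact hz' (mem_iUnion.2 ⟨m, hm⟩)
  obtain ⟨F, hFS, hFc, hFpos⟩ := exists_isClosed_subset_measure_pos ψ (hSm n) hn
  refine ⟨F, hFS.trans fun x hx => hx.1, hFc, hFpos, hFc.measurableSet,
    (timeMeasure.toFinite.prod timeMeasure.toFinite).map (fun q => q.1 + q.2),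
    (((n : ℝ≥0∞) + 1)⁻¹ * ((m : ℝ≥0∞) + 1)⁻¹ * (1 / 2)) • φ.restrict (R m), ?_, ?_, ?_, ?_⟩
  · exact Measure.isProbabilityMeasure_map (by fun_prop)
  · have : IsFiniteMeasure ((((n : ℝ≥0∞) + 1)⁻¹ * ((m : ℝ≥0∞) + 1)⁻¹ * (1 / 2)) •
        φ.restrict (R m)) := by
      refine Measure.smul_finite _ (ENNReal.mul_ne_top (ENNReal.mul_ne_top ?_ ?_) ?_) <;> simp
    infer_instance
  · intro h0
    have h1 := congrArg (fun ν => ν univ) h0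
    simp only [Measure.smul_apply, Measure.restrict_apply_univ, Measure.coe_zero, Pi.zero_apply,
      smul_eq_mul, mul_eq_zero, hm, or_false] at h1
    simp [ENNReal.add_eq_top] at h1
  · intro x hx A hA
    rw [← lintegral_sampled_sampled _ _ x hA, ← resolvent]
    have hxn := (hFS hx).2
    calc _ = ∫⁻ z in A ∩ R m, ((n : ℝ≥0∞) + 1)⁻¹ * ((m : ℝ≥0∞) + 1)⁻¹ * (1 / 2) ∂φ := by
          rw [setLIntegral_const, Measure.smul_apply, Measure.restrict_apply hA, smul_eq_mul]
      _ ≤ ∫⁻ z in A ∩ R m, ∫⁻ y, d x y * d y z ∂φ ∂φ := by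
          refine setLIntegral_mono' (hA.inter (hRm m)) fun z hz => ?_
          have h1 := one_half_le_measure_inter φ (measurable_prodMk_right (hlevel m)) hxn hz.2
          have hms : MeasurableSet ({y | ((n : ℝ≥0∞) + 1)⁻¹ ≤ d x y} ∩
              {y | ((m : ℝ≥0∞) + 1)⁻¹ ≤ d y z}) :=
            (measurable_prodMk_left (hlevel n)).inter (measurable_prodMk_right (hlevel m))
          calc _ ≤ ((n : ℝ≥0∞) + 1)⁻¹ * ((m : ℝ≥0∞) + 1)⁻¹ *
                φ ({y | ((n : ℝ≥0∞) + 1)⁻¹ ≤ d x y} ∩ {y | ((m : ℝ≥0∞) + 1)⁻¹ ≤ d y z}) := by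
                gcongr
                exact h1
            _ = ∫⁻ y in {y | ((n : ℝ≥0∞) + 1)⁻¹ ≤ d x y} ∩ {y | ((m : ℝ≥0∞) + 1)⁻¹ ≤ d y z},
                ((n : ℝ≥0∞) + 1)⁻¹ * ((m : ℝ≥0∞) + 1)⁻¹ ∂φ := by rw [setLIntegral_const]
            _ ≤ ∫⁻ y in {y | ((n : ℝ≥0∞) + 1)⁻¹ ≤ d x y} ∩ {y | ((m : ℝ≥0∞) + 1)⁻¹ ≤ d y z},
                d x y * d y z ∂φ := setLIntegral_mono' hms fun y hy => mul_le_mul' hy.1 hy.2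
            _ ≤ _ := setLIntegral_le_lintegral _ _
      _ ≤ ∫⁻ z in A, ∫⁻ y, d x y * d y z ∂φ ∂φ := lintegral_mono_set inter_subset_left
      _ = ∫⁻ y, ∫⁻ z in A, d x y * d y z ∂φ ∂φ := by
          refine lintegral_lintegral_swap (Measurable.aemeasurable ?_)
          exact (hdm.comp (measurable_const.prodMk measurable_snd)).mul
            (hdm.comp (measurable_snd.prodMk measurable_fst))
      _ = ∫⁻ y, d x y * ∫⁻ z, d y z * A.indicator 1 z ∂φ ∂φ := by
          refine lintegral_congr fun y => ?_
          have hdy : Measurable (d y) := hdm.comp measurable_prodMk_left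
          rw [lintegral_const_mul _ hdy, ← lintegral_indicator hA]
          congr 2
          ext z
          by_cases hz : z ∈ A <;> simp [hz]
      _ ≤ ∫⁻ y, d x y * M.resolvent y A ∂φ := by
          refine lintegral_mono fun y => ?_
          gcongr
          rw [← lintegral_indicator_one hA]
          exact hle y (measurable_one.indicator hA)
      _ ≤ _ := hle x (M.resolvent.measurable_coe hA)

/-- From a petite set, an accessible set is visited on a uniform time horizon with a probability
bounded away from `0`. -/
theorem IsPetite.exists_occupation {C B : Set E} (hC : M.IsPetite C) (hB : MeasurableSet B)
    (hB' : ∀ x, M.resolvent x B ≠ 0) (t : ℝ≥0) : ∃ L : ℝ≥0, ∃ γ : ℝ≥0∞, 0 < γ ∧ ∀ x ∈ C,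
      γ ≤ M.pathLaw x {p | 0 < occupation B t L p} := by
  obtain ⟨-, a, ν, _, _, hν0, hν⟩ := hC
  have hSm (u : ℝ≥0) : MeasurableSet {p : CadlagPath E | 0 < occupation B t u p} :=
    measurableSet_lt measurable_const (measurable_occupation hB t measurable_const measurable_id)
  have hm (u : ℝ≥0) : Measurable fun x => M.pathLaw x {p | 0 < occupation B t u p} :=
    M.pathLaw.measurable_coe (hSm u)
  -- Otherwise, by the Markov property at `t`, the resolvent from almost every state at time `t`
  -- ignores `B`, against `hB'`.
  have hex (x : E) : ∃ n : ℕ, M.pathLaw x {p | 0 < occupation B t n p} ≠ 0 := by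
    by_contra! h
    have h1 : ∀ᵐ p ∂M.pathLaw x, ∀ n : ℕ, occupation B t n p = 0 := by
      refine ae_all_iff.2 fun n => ?_
      filter_upwards [measure_eq_zero_iff_ae_notMem.1 (h n)] with p hp
      simpa using hp
    have h2 := M.lintegral_shift_const x t (measurable_measure_times timeMeasure.toFinite hB)
    have h3 : ∫⁻ p, timeMeasure.toFinite {u | (shift t p).1 u ∈ B} ∂M.pathLaw x = 0 := by
      refine lintegral_eq_zero_of_ae_eq_zero ?_
      filter_upwards [h1] with p hp
      rw [Pi.zero_apply, toFinite_apply_eq_zero_iff]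
      have h4 : {u | (shift t p).1 u ∈ B} ⊆
          ⋃ n : ℕ, {v | (shift t p).1 v ∈ B} ∩ Ico 0 (n : ℝ≥0) := by
        intro v hv
        obtain ⟨n, hn⟩ := exists_nat_gt v
        exact mem_iUnion.2 ⟨n, hv, zero_le, hn⟩
      refine measure_mono_null h4 (measure_iUnion_null fun n => ?_)
      have h5 := occupation_shift hB t 0 n p
      rw [add_zero] at h5
      obtain ⟨k, hk⟩ := exists_nat_ge (t + n)
      refine le_antisymm (h5.le.trans ?_) zero_le
      exact (occupation_mono B le_rfl hk p).trans (hp k).le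
    rw [h3] at h2
    have h4 : Measurable fun p : CadlagPath E => M.resolvent (p.1 t) B :=
      (M.resolvent.measurable_coe hB).comp (measurable_eval t)
    have h5 := (lintegral_eq_zero_iff h4).1 (by
      simp only [resolvent, sampled_apply' _ _ hB]
      exact h2.symm)
    obtain ⟨p, hp⟩ := h5.exists
    exact hB' _ hp
  obtain ⟨n, hn⟩ : ∃ n : ℕ, ∫⁻ y, M.pathLaw y {p | 0 < occupation B t n p} ∂ν ≠ 0 := by
    by_contra! h
    have h1 : ∀ᵐ y ∂ν, ∀ n : ℕ, M.pathLaw y {p | 0 < occupation B t n p} = 0 :=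
      ae_all_iff.2 fun n => (lintegral_eq_zero_iff (hm n)).1 (h n)
    have : (ae ν).NeBot := ae_neBot.2 hν0
    obtain ⟨y, hy⟩ := h1.exists
    obtain ⟨n, hn⟩ := hex y
    exact hn (hy n)
  set c := ∫⁻ y, M.pathLaw y {p | 0 < occupation B t n p} ∂ν with hc
  obtain ⟨m, hm'⟩ : ∃ m : ℕ, a (Ici (m : ℝ≥0)) < c := by
    have h1 : Tendsto (fun m : ℕ => a (Ici (m : ℝ≥0))) atTop (𝓝 (a (⋂ m : ℕ, Ici (m : ℝ≥0)))) :=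
      tendsto_measure_iInter_atTop (fun m => measurableSet_Ici.nullMeasurableSet)
        (fun i j hij => Ici_subset_Ici.2 (by exact_mod_cast hij)) ⟨0, measure_ne_top _ _⟩
    have h2 : (⋂ m : ℕ, Ici (m : ℝ≥0)) = ∅ := by
      refine eq_empty_of_forall_notMem fun u hu => ?_
      obtain ⟨k, hk⟩ := exists_nat_gt u
      exact absurd (mem_iInter.1 hu k) (not_le.2 hk)
    rw [h2, measure_empty] at h1
    exact (h1.eventually (gt_mem_nhds (pos_iff_ne_zero.2 hn))).exists
  -- A sampling time below `m` followed by occupation within `n` gives occupation within `m + n`;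
  -- sampling times beyond `m` are discarded at the price of the tail of `a`.
  refine ⟨m + n, c - a (Ici (m : ℝ≥0)), tsub_pos_of_lt hm', fun x hx => ?_⟩
  rw [tsub_le_iff_right]
  have hle : ν ≤ M.sampled a x := Measure.le_iff.2 fun A hA => by
    rw [sampled_apply a x hA]
    exact hν x hx A hA
  have hshift (u : ℝ≥0) : ∫⁻ p, M.pathLaw (p.1 u) {p | 0 < occupation B t n p} ∂M.pathLaw x =
      M.pathLaw x {p | 0 < occupation B t n (shift u p)} := by
    have h := M.lintegral_shift_const x u (G := {p | 0 < occupation B t n p}.indicator 1)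
      (measurable_one.indicator (hSm n))
    simp only [lintegral_indicator_one (hSm n)] at h
    rw [← h]
    exact lintegral_indicator_one ((measurable_const.cadlagPath_shift measurable_id) (hSm n))
  calc c ≤ ∫⁻ y, M.pathLaw y {p | 0 < occupation B t n p} ∂M.sampled a x :=
        lintegral_mono' hle le_rfl
    _ = ∫⁻ u, M.pathLaw x {p | 0 < occupation B t n (shift u p)} ∂a := by
        rw [lintegral_sampled a x (hm n)]
        simp only [hshift]
    _ = (∫⁻ u in Iio (m : ℝ≥0), M.pathLaw x {p | 0 < occupation B t n (shift u p)} ∂a) +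
        ∫⁻ u in Ici (m : ℝ≥0), M.pathLaw x {p | 0 < occupation B t n (shift u p)} ∂a := by
        rw [← compl_Iio, lintegral_add_compl _ measurableSet_Iio]
    _ ≤ (∫⁻ u in Iio (m : ℝ≥0), M.pathLaw x {p | 0 < occupation B t (m + n) p} ∂a) +
        ∫⁻ u in Ici (m : ℝ≥0), 1 ∂a := by
        refine add_le_add (setLIntegral_mono' measurableSet_Iio fun u hu => ?_)
          (lintegral_mono fun u => prob_le_one)
        refine measure_mono fun p hp => ?_
        simp only [mem_ofPred_eq, occupation_shift hB] at hp ⊢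
        exact hp.trans_le (occupation_mono B le_add_self (by gcongr; exact hu.le) p)
    _ ≤ M.pathLaw x {p | 0 < occupation B t (m + n) p} + a (Ici (m : ℝ≥0)) := by
        rw [setLIntegral_const, setLIntegral_const, one_mul]
        gcongr
        exact mul_le_of_le_one_right' prob_le_one

end StrongMarkovFamily

/-! ### Pathwise costs and their splitting -/

namespace CadlagPath

variable {E : Type*} [TopologicalSpace E]

/-- The cost accumulated up to time `z` when the clock of the rate `r` starts at `s`. -/
noncomputable def cost (f : E → ℝ≥0) (r : ℝ≥0 → ℝ≥0) (s : ℝ≥0) (z : ℝ≥0∞) (p : CadlagPath E) :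
    ℝ≥0∞ :=
  ∫⁻ u in {u : ℝ≥0 | (u : ℝ≥0∞) < z}, ((r (s + u) * f (p.1 u) : ℝ≥0) : ℝ≥0∞) ∂timeMeasure

/-- The cost, for a time-dependent cost function `φ`, accumulated until the time spent in `B` after
time `t` becomes positive. -/
noncomputable def costUntil (B : Set E) (t : ℝ≥0) (r : ℝ≥0 → ℝ≥0) (φ : ℝ≥0 → E → ℝ≥0∞) (s : ℝ≥0)
    (p : CadlagPath E) : ℝ≥0∞ :=
  ∫⁻ u, {u | occupation B t u p = 0}.indicator (fun u => r (s + u) * φ u (p.1 u)) u ∂timeMeasure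

theorem measurableSet_coe_lt (z : ℝ≥0∞) : MeasurableSet {u : ℝ≥0 | (u : ℝ≥0∞) < z} :=
  measurableSet_lt (by fun_prop) measurable_const

theorem setOf_coe_lt_coe (s : ℝ≥0) : {u : ℝ≥0 | (u : ℝ≥0∞) < s} = Iio s := by
  ext; simp

theorem cost_mono (f : E → ℝ≥0) (r : ℝ≥0 → ℝ≥0) (s : ℝ≥0) {z z' : ℝ≥0∞} (h : z ≤ z')
    (p : CadlagPath E) : cost f r s z p ≤ cost f r s z' p :=
  lintegral_mono_set fun _ hu => lt_of_lt_of_le hu h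

variable {f : E → ℝ≥0} {r : ℝ≥0 → ℝ≥0}

theorem cost_le_mul (h : IsSubgeometricRate₀ r) (s : ℝ≥0) (z : ℝ≥0∞) (p : CadlagPath E) :
    cost f r s z p ≤ r s * cost f r 0 z p := by
  rw [cost, cost, ← lintegral_const_mul' _ _ ENNReal.coe_ne_top]
  refine lintegral_mono fun u => ?_
  rw [zero_add, ← ENNReal.coe_mul, ENNReal.coe_le_coe, ← mul_assoc]
  gcongr
  exact h.add_le_mul s u

theorem lintegral_rate_le_cost (hf1 : ∀ x, 1 ≤ f x) (z : ℝ≥0) (p : CadlagPath E) :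
    ∫⁻ u in Iio z, r u ∂timeMeasure ≤ cost f r 0 z p := by
  rw [cost, setOf_coe_lt_coe]
  refine lintegral_mono fun u => ?_
  rw [zero_add, ENNReal.coe_le_coe]
  exact le_mul_of_one_le_right zero_le (hf1 _)

/-- This supplies the a priori finiteness needed to subtract `κ` in the contraction argument. -/
theorem costUntil_le_of_bounded {B : Set E} {φ : ℝ≥0 → E → ℝ≥0∞}
    (h : IsSubgeometricRate₀ r) (t s : ℝ≥0) {n : ℕ}
    (hφn : ∀ u x, φ u x ≤ (Iio (n : ℝ≥0)).indicator (fun _ => (n : ℝ≥0∞)) u)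
    (p : CadlagPath E) : costUntil B t r φ s p ≤ r s * (r n * n * n) := by
  calc costUntil B t r φ s p ≤ ∫⁻ u, (Iio (n : ℝ≥0)).indicator
        (fun _ => (r s * (r n * n) : ℝ≥0∞)) u ∂timeMeasure := by
        refine lintegral_mono fun u => (indicator_le_self _ _ _).trans ?_
        by_cases hu : u < n
        · have h1 := hφn u (p.1 u)
          rw [indicator_of_mem (by exact hu)] at h1 ⊢
          rw [← mul_assoc]
          refine mul_le_mul' ?_ h1
          rw [← ENNReal.coe_mul]
          refine ENNReal.coe_le_coe.2 ((h.add_le_mul s u).trans ?_)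
          gcongr
          exact h.2.1 hu.le
        · have h1 := hφn u (p.1 u)
          rw [indicator_of_notMem (by exact hu)] at h1 ⊢
          rw [nonpos_iff_eq_zero.1 h1, mul_zero]
    _ = _ := by
        rw [lintegral_indicator measurableSet_Iio, setLIntegral_const, timeMeasure_Iio]
        push_cast
        ring

variable [TopologicalSpace.PseudoMetrizableSpace E] [MeasurableSpace E] [BorelSpace E]
  {B : Set E}

theorem measurable_cost (hf : Measurable f) (hr : Measurable r) {α : Type*} [MeasurableSpace α]
    {S : α → ℝ≥0} {Z : α → ℝ≥0∞} {g : α → CadlagPath E} (hS : Measurable S) (hZ : Measurable Z)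
    (hg : Measurable g) : Measurable fun a => cost f r (S a) (Z a) (g a) := by
  have h1 : MeasurableSet {q : α × ℝ≥0 | (q.2 : ℝ≥0∞) < Z q.1} :=
    measurableSet_lt (by fun_prop) (hZ.comp measurable_fst)
  have h2 : Measurable fun q : α × ℝ≥0 => ((r (S q.1 + q.2) * f ((g q.1).1 q.2) : ℝ≥0) : ℝ≥0∞) :=
    ((hr.comp ((hS.comp measurable_fst).add measurable_snd)).mul
      (hf.comp (measurable_snd.cadlagPath_eval (hg.comp measurable_fst)))).coe_nnreal_ennreal
  have h3 := (h2.indicator h1).lintegral_prod_right' (ν := timeMeasure)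
  convert h3 using 2 with a
  rw [cost, ← lintegral_indicator (measurableSet_coe_lt _)]
  rfl

theorem measurable_cost_integrand (hf : Measurable f) (hr : Measurable r) (s : ℝ≥0)
    (p : CadlagPath E) : Measurable fun u => ((r (s + u) * f (p.1 u) : ℝ≥0) : ℝ≥0∞) :=
  ((hr.comp (measurable_id.const_add s)).mul
    (hf.comp (measurable_id.cadlagPath_eval measurable_const))).coe_nnreal_ennreal

theorem cost_add (hf : Measurable f) (hr : Measurable r) (s : ℝ≥0) (z : ℝ≥0∞)
    (p : CadlagPath E) : cost f r 0 (s + z) p = cost f r 0 s p + cost f r s z (shift s p) := by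
  have hm := measurable_cost_integrand hf hr 0 p
  have hA := measurableSet_coe_lt (s + z)
  have hg := hm.indicator hA
  have h1 := lintegral_add_timeMeasure s hg
  have h2 : cost f r s z (shift s p) =
      ∫⁻ u in Ici s, {u : ℝ≥0 | (u : ℝ≥0∞) < s + z}.indicator
        (fun u => ((r (0 + u) * f (p.1 u) : ℝ≥0) : ℝ≥0∞)) u ∂timeMeasure := by
    rw [← h1, cost, ← lintegral_indicator (measurableSet_coe_lt z)]
    refine lintegral_congr fun u => ?_
    have e : ((s + u : ℝ≥0) : ℝ≥0∞) < s + z ↔ (u : ℝ≥0∞) < z := by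
      rw [ENNReal.coe_add]
      exact ENNReal.add_lt_add_iff_left ENNReal.coe_ne_top
    by_cases hu : (u : ℝ≥0∞) < z
    · rw [indicator_of_mem (by exact hu), indicator_of_mem (by exact e.2 hu), zero_add]
      rfl
    · rw [indicator_of_notMem (by exact hu), indicator_of_notMem (by exact fun h => hu (e.1 h))]
  have h3 : cost f r 0 s p =
      ∫⁻ u in Iio s, {u : ℝ≥0 | (u : ℝ≥0∞) < s + z}.indicator
        (fun u => ((r (0 + u) * f (p.1 u) : ℝ≥0) : ℝ≥0∞)) u ∂timeMeasure := by
    rw [cost, setOf_coe_lt_coe]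
    refine setLIntegral_congr_fun measurableSet_Iio fun u hu => ?_
    have hu' : u ∈ {u : ℝ≥0 | (u : ℝ≥0∞) < s + z} :=
      lt_of_lt_of_le (ENNReal.coe_lt_coe.2 hu) le_self_add
    simp only [indicator_of_mem hu']
  rw [h2, h3, ← compl_Iio, lintegral_add_compl _ measurableSet_Iio, lintegral_indicator hA]
  rfl

section CostUntil

variable {φ : ℝ≥0 → E → ℝ≥0∞}

theorem measurableSet_occupation_eq_zero (hB : MeasurableSet B) (t : ℝ≥0) (p : CadlagPath E) :
    MeasurableSet {u | occupation B t u p = 0} :=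
  (measurable_occupation hB t measurable_id measurable_const) (measurableSet_singleton 0)

theorem measurable_costUntil_integrand (hr : Measurable r)
    (hφ : Measurable fun q : ℝ≥0 × E => φ q.1 q.2) (s : ℝ≥0) (p : CadlagPath E) :
    Measurable fun u => r (s + u) * φ u (p.1 u) :=
  (hr.comp (measurable_id.const_add s)).coe_nnreal_ennreal.mul
    (hφ.comp (measurable_id.prodMk (measurable_id.cadlagPath_eval measurable_const)))

theorem measurable_costUntil (hB : MeasurableSet B) (t : ℝ≥0) (hr : Measurable r)
    (hφ : Measurable fun q : ℝ≥0 × E => φ q.1 q.2) {α : Type*} [MeasurableSpace α]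
    {S : α → ℝ≥0} {g : α → CadlagPath E} (hS : Measurable S) (hg : Measurable g) :
    Measurable fun a => costUntil B t r φ (S a) (g a) := by
  have h1 : MeasurableSet {q : α × ℝ≥0 | occupation B t q.2 (g q.1) = 0} :=
    (measurable_occupation hB t measurable_snd (hg.comp measurable_fst))
      (measurableSet_singleton 0)
  have h2 : Measurable fun q : α × ℝ≥0 => (r (S q.1 + q.2) : ℝ≥0∞) * φ q.2 ((g q.1).1 q.2) :=
    (hr.comp ((hS.comp measurable_fst).add measurable_snd)).coe_nnreal_ennreal.mul
      (hφ.comp (measurable_snd.prodMk (measurable_snd.cadlagPath_eval (hg.comp measurable_fst))))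
  exact (h2.indicator h1).lintegral_prod_right' (ν := timeMeasure)

/-- Split at time `z`. The first piece is handled by submultiplicativity. If `B` was occupied before
`L ≤ z`, nothing is due afterwards; if not, the remaining cost is at most that of the shifted path,
whose occupation window is contained in the original one and whose cost function is restarted, hence
no smaller by `hφa`. -/
theorem costUntil_le (hB : MeasurableSet B) (t : ℝ≥0) (h : IsSubgeometricRate₀ r)
    (hφ : Measurable fun q : ℝ≥0 × E => φ q.1 q.2) (hφf : ∀ u x, φ u x ≤ f x)
    (hφa : ∀ v u x, φ (v + u) x ≤ φ u x) (s : ℝ≥0) {L : ℝ≥0} {z : ℝ≥0∞} (hL : L ≤ z)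
    (p : CadlagPath E) :
    costUntil B t r φ s p ≤ r s * cost f r 0 z p +
      {p : CadlagPath E | occupation B t L p = 0 ∧ z ≠ ∞}.indicator
        (fun p => costUntil B t r φ (s + z.toNNReal) (shift z.toNNReal p)) p := by
  have hm := (measurable_costUntil_integrand h.1 hφ s p).indicator
    (measurableSet_occupation_eq_zero hB t p)
  have hcost (A : Set ℝ≥0) (hA : A ⊆ {u : ℝ≥0 | (u : ℝ≥0∞) < z}) :
      ∫⁻ u in A, {u | occupation B t u p = 0}.indicator
        (fun u => r (s + u) * φ u (p.1 u)) u ∂timeMeasure ≤ r s * cost f r 0 z p := by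
    rw [cost, ← lintegral_const_mul' _ _ ENNReal.coe_ne_top]
    refine (lintegral_mono_set hA).trans (lintegral_mono fun u => ?_)
    refine (indicator_le_self _ _ _).trans ?_
    rw [zero_add, ENNReal.coe_mul, ← mul_assoc]
    refine mul_le_mul' ?_ (hφf _ _)
    rw [← ENNReal.coe_mul]
    exact ENNReal.coe_le_coe.2 (h.add_le_mul s u)
  rcases eq_or_ne z ∞ with rfl | hz
  · refine le_trans ?_ le_self_add
    have := hcost univ (fun u _ => ENNReal.coe_lt_top)
    rwa [Measure.restrict_univ] at this
  lift z to ℝ≥0 using hz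
  rw [ENNReal.toNNReal_coe]
  rw [costUntil, ← lintegral_add_compl _ (measurableSet_Iio (a := z)), compl_Iio,
    ← lintegral_add_timeMeasure z hm]
  refine add_le_add (hcost _ (setOf_coe_lt_coe z).ge) ?_
  have hLz : L ≤ z := by exact_mod_cast hL
  by_cases hocc : occupation B t L p = 0
  · rw [indicator_of_mem (by exact ⟨hocc, ENNReal.coe_ne_top⟩), costUntil]
    refine lintegral_mono fun u => ?_
    by_cases hu : occupation B t (z + u) p = 0
    · have hu' : occupation B t u (shift z p) = 0 := by
        rw [occupation_shift hB]
        exact le_antisymm ((occupation_mono B le_add_self le_rfl p).trans hu.le) zero_le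
      rw [indicator_of_mem (by exact hu), indicator_of_mem (by exact hu'), add_assoc, shift_apply]
      gcongr
      exact hφa z u _
    · rw [indicator_of_notMem (by exact hu)]
      exact zero_le
  · refine le_of_eq_of_le ?_ zero_le
    refine lintegral_eq_zero_of_ae_eq_zero (.of_forall fun u => ?_)
    refine indicator_of_notMem (fun hu => hocc ?_) _
    exact le_antisymm ((occupation_mono B le_rfl (hLz.trans le_self_add) p).trans
      (le_of_eq hu)) zero_le

end CostUntil

end CadlagPath

/-! ### Iterated returns and the contraction argument -/

namespace StrongMarkovFamily

open CadlagPath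

variable {E Ω : Type*} [PseudoMetricSpace E] [MeasurableSpace E] [BorelSpace E]
  [MeasurableSpace Ω] {M : StrongMarkovFamily E Ω} {f : E → ℝ≥0} {r : ℝ≥0 → ℝ≥0} {B C : Set E}

variable (M f r C) in
/-- From every point of `C`, the expected cost until the first visit to `C` after time `δ` is at
most `K`. -/
def ReturnBound (δ : ℝ≥0) (K : ℝ≥0∞) : Prop :=
  ∀ x ∈ C, ∀ T, IsOptional T → (∀ p, T p ≤ hitAfter C (fun _ => δ) p) →
    ∫⁻ p, cost f r 0 (T p) p ∂M.pathLaw x ≤ K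

/-- Use `hs` at the value of `T`; as `f ≥ 1`, the integral of the rate is at most the cost. The
factor `M.pathLaw x F` is kept apart from the `ε` term, since it will bring the gain `1 - γ`. -/
theorem lintegral_rate_add_le (h : IsSubgeometricRate₀ r) (hf : Measurable f) (hf1 : ∀ x, 1 ≤ f x)
    {ε s : ℝ≥0} (hs : ∀ t : ℝ≥0,
      (r (s + t) : ℝ≥0∞) ≤ r s * (1 + ε * (1 + ∫⁻ u in Iio t, r u ∂timeMeasure)))
    (x : E) {T : CadlagPath E → ℝ≥0∞} (hT : IsOptional T) {F : Set (CadlagPath E)}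
    (hF : IsPrior T F) :
    ∫⁻ p in {p | p ∈ F ∧ T p ≠ ∞}, r (s + (T p).toNNReal) ∂M.pathLaw x ≤
      r s * (M.pathLaw x F + ε * (1 + ∫⁻ p, cost f r 0 (T p) p ∂M.pathLaw x)) := by
  have hm : Measurable fun p : CadlagPath E => cost f r 0 (T p) p :=
    measurable_cost hf h.1 measurable_const hT.measurable measurable_id'
  calc _ ≤ ∫⁻ p in {p | p ∈ F ∧ T p ≠ ∞}, r s * (1 + ε * (1 + cost f r 0 (T p) p))
        ∂M.pathLaw x := by
        refine setLIntegral_mono' hF.measurableSet fun p hp => (hs _).trans ?_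
        gcongr
        have := lintegral_rate_le_cost (r := r) hf1 (T p).toNNReal p
        rwa [ENNReal.coe_toNNReal hp.2] at this
    _ = r s * (M.pathLaw x {p | p ∈ F ∧ T p ≠ ∞} +
        ε * (M.pathLaw x {p | p ∈ F ∧ T p ≠ ∞} +
          ∫⁻ p in {p | p ∈ F ∧ T p ≠ ∞}, cost f r 0 (T p) p ∂M.pathLaw x)) := by
        rw [lintegral_const_mul' _ _ ENNReal.coe_ne_top, lintegral_add_left measurable_const,
          lintegral_const_mul' _ _ ENNReal.coe_ne_top, lintegral_add_left measurable_const]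
        simp
    _ ≤ _ := by
        gcongr
        · exact fun p hp => hp.1
        · exact prob_le_one
        · exact Measure.restrict_le_self

/-- If the first visit to `C` after time `δ` has a finite expected cost, uniformly on `C`, so does
the first visit after time `δ' + δ`. -/
theorem ReturnBound.add (hC : IsClosed C) (h : IsSubgeometricRate₀ r) (hf : Measurable f)
    (hf1 : ∀ x, 1 ≤ f x) {δ δ' : ℝ≥0} {K K' : ℝ≥0∞} (hK : M.ReturnBound f r C δ K)
    (hK' : M.ReturnBound f r C δ' K') (hKfin : K ≠ ∞) (hKfin' : K' ≠ ∞) :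
    ∃ K'' ≠ ∞, M.ReturnBound f r C (δ' + δ) K'' := by
  obtain ⟨s₀, hs₀⟩ := h.exists_add_le (ε := 1) one_pos
  refine ⟨K' + r s₀ * (1 + 1 * (1 + K')) * K, ?_, fun x hx T hT hTle => ?_⟩
  · refine ENNReal.add_ne_top.2 ⟨hKfin', ENNReal.mul_ne_top (ENNReal.mul_ne_top
      ENNReal.coe_ne_top ?_) hKfin⟩
    simpa using hKfin'
  obtain ⟨S, hS, hSδ, hSle, hSC⟩ := exists_isOptional_eval_mem_ae (M.pathLaw x) hC δ'
  have hK1 := hK' x hx S hS hSle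
  set A : Set (CadlagPath E) := {p | p ∈ univ ∧ S p ≠ ∞} with hA
  have hAm : MeasurableSet A := hS.isPrior_univ.measurableSet
  obtain ⟨R, hR, hRδ, hRle, hRC⟩ := exists_isOptional_eval_mem_ae
    (((M.pathLaw x).restrict A).map (fun p => shift (S p).toNNReal p)) hC δ
  have hRC' := (ae_restrict_iff' hAm).1
    (ae_of_ae_map (measurable_shift_toNNReal hS).aemeasurable hRC)
  have hG : Measurable fun q : ℝ≥0 × CadlagPath E => cost f r q.1 (R q.2) q.2 :=
    measurable_cost hf h.1 measurable_fst (hR.measurable.comp measurable_snd) measurable_snd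
  calc ∫⁻ p, cost f r 0 (T p) p ∂M.pathLaw x
      ≤ ∫⁻ p, cost f r 0 (S p) p + A.indicator (fun p => cost f r (S p).toNNReal
          (R (shift (S p).toNNReal p)) (shift (S p).toNNReal p)) p ∂M.pathLaw x := by
        refine lintegral_mono_ae ?_
        filter_upwards [hSC, hRC'] with p hp1 hp2
        by_cases hp : S p = ∞
        · rw [hp]
          exact (cost_mono f r 0 le_top p).trans le_self_add
        have hpA : p ∈ A := ⟨mem_univ _, hp⟩
        rw [indicator_of_mem hpA]
        have hc := cost_add hf h.1 (S p).toNNReal (R (shift (S p).toNNReal p)) p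
        rw [ENNReal.coe_toNNReal hp] at hc
        rw [← hc]
        refine cost_mono f r 0 ?_ p
        rcases eq_or_ne (R (shift (S p).toNNReal p)) ∞ with hR' | hR'
        · rw [hR', add_top]
          exact le_top
        refine (hTle p).trans ?_
        have hmem := hp2 hpA hR'
        rw [shift_apply] at hmem
        refine (hitAfter_le (t := (S p).toNNReal + (R (shift (S p).toNNReal p)).toNNReal)
          ?_ hmem).trans ?_
        · push_cast
          rw [ENNReal.coe_toNNReal hp, ENNReal.coe_toNNReal hR']
          exact add_le_add (hSδ p) (hRδ _)
        · push_cast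
          rw [ENNReal.coe_toNNReal hp, ENNReal.coe_toNNReal hR']
    _ = (∫⁻ p, cost f r 0 (S p) p ∂M.pathLaw x) + ∫⁻ p in A, cost f r (S p).toNNReal
          (R (shift (S p).toNNReal p)) (shift (S p).toNNReal p) ∂M.pathLaw x := by
        rw [lintegral_add_left (measurable_cost hf h.1 measurable_const hS.measurable
          measurable_id'), lintegral_indicator hAm]
    _ = (∫⁻ p, cost f r 0 (S p) p ∂M.pathLaw x) + ∫⁻ p in A, ∫⁻ q,
          cost f r (S p).toNNReal (R q) q ∂M.pathLaw (p.1 (S p).toNNReal) ∂M.pathLaw x := by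
        rw [← M.lintegral_shift x hS hS.isPrior_univ hG]
    -- Monotonicity lets the clock be advanced by `s₀`, into the region where the growth inequality
    -- holds.
    _ ≤ K' + ∫⁻ p in A, r (s₀ + (S p).toNNReal) * K ∂M.pathLaw x := by
        refine add_le_add hK1 (lintegral_mono_ae ?_)
        filter_upwards [ae_restrict_of_ae hSC, ae_restrict_mem hAm] with p hp1 hp2
        calc _ ≤ ∫⁻ q, r (S p).toNNReal * cost f r 0 (R q) q
              ∂M.pathLaw (p.1 (S p).toNNReal) := lintegral_mono fun q => cost_le_mul h _ _ _
          _ = r (S p).toNNReal * ∫⁻ q, cost f r 0 (R q) q ∂M.pathLaw (p.1 (S p).toNNReal) :=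
              lintegral_const_mul' _ _ ENNReal.coe_ne_top
          _ ≤ _ := mul_le_mul' (ENNReal.coe_le_coe.2 (h.2.1 le_add_self))
              (hK _ (hp1 hp2.2) R hR hRle)
    _ ≤ K' + r s₀ * (1 + 1 * (1 + K')) * K := by
        rw [lintegral_mul_const' _ _ hKfin]
        gcongr
        refine (lintegral_rate_add_le h hf hf1 (ε := 1) (s := s₀) (hs₀ s₀ le_rfl) x hS
          hS.isPrior_univ).trans ?_
        gcongr
        · exact prob_le_one
        · simp

theorem ReturnBound.exists_ge (hC : IsClosed C) (h : IsSubgeometricRate₀ r) (hf : Measurable f)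
    (hf1 : ∀ x, 1 ≤ f x) {δ : ℝ≥0} (hδ : 0 < δ) {K : ℝ≥0∞} (hK : M.ReturnBound f r C δ K)
    (hKfin : K ≠ ∞) (L : ℝ≥0) : ∃ L' ≥ L, ∃ K' ≠ ∞, M.ReturnBound f r C L' K' := by
  have key (n : ℕ) : ∃ K' ≠ ∞, M.ReturnBound f r C ((n + 1 : ℕ) * δ) K' := by
    induction n with
    | zero => exact ⟨K, hKfin, by simpa using hK⟩
    | succ n ih =>
      obtain ⟨K', hK', hb⟩ := ih
      obtain ⟨K'', hK'', hb'⟩ := ReturnBound.add hC h hf hf1 hK hb hKfin hK'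
      refine ⟨K'', hK'', ?_⟩
      convert hb' using 1
      push_cast
      ring
  obtain ⟨n, hn⟩ := exists_nat_ge (L / δ)
  refine ⟨_, ?_, key n⟩
  rw [div_le_iff₀ hδ] at hn
  refine hn.trans ?_
  gcongr
  omega

section CostUntil

variable {φ : ℝ≥0 → E → ℝ≥0∞}

theorem lintegral_costUntil_le (hB : MeasurableSet B) (t : ℝ≥0) (h : IsSubgeometricRate₀ r)
    (hf : Measurable f)
    (hφ : Measurable fun q : ℝ≥0 × E => φ q.1 q.2) (hφf : ∀ u x, φ u x ≤ f x)
    (hφa : ∀ v u x, φ (v + u) x ≤ φ u x) (s : ℝ≥0) {L : ℝ≥0} {T : CadlagPath E → ℝ≥0∞}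
    (hT : IsOptional T) (hL : ∀ p, L ≤ T p) (x : E) :
    ∫⁻ p, costUntil B t r φ s p ∂M.pathLaw x ≤
      r s * (∫⁻ p, cost f r 0 (T p) p ∂M.pathLaw x) +
        ∫⁻ p in {p | p ∈ {p | occupation B t L p = 0} ∧ T p ≠ ∞},
          ∫⁻ q, costUntil B t r φ (s + (T p).toNNReal) q ∂M.pathLaw (p.1 (T p).toNNReal)
            ∂M.pathLaw x := by
  have hF : IsPrior T {p | occupation B t L p = 0} :=
    IsPrior.of_past (measurable_past_occupation hB t L (measurableSet_singleton 0)) hT hL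
  have hG : Measurable fun q : ℝ≥0 × CadlagPath E => costUntil B t r φ (s + q.1) q.2 :=
    measurable_costUntil hB t h.1 hφ (measurable_fst.const_add s) measurable_snd
  rw [← M.lintegral_shift x hT hF hG, ← lintegral_indicator hF.measurableSet,
    ← lintegral_const_mul' _ _ ENNReal.coe_ne_top, ← lintegral_add_left
      ((measurable_cost hf h.1 measurable_const hT.measurable measurable_id').const_mul _)]
  refine lintegral_mono fun p => (costUntil_le hB t h hφ hφf hφa s (hL p) p).trans ?_
  gcongr
  by_cases hp : occupation B t L p = 0 ∧ T p ≠ ∞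
  · rw [indicator_of_mem (by exact hp), indicator_of_mem (by exact hp)]
  · rw [indicator_of_notMem (by exact hp)]
    exact zero_le

end CostUntil

theorem le_div_of_le_add_mul {κ K : ℝ≥0∞} {γ : ℝ≥0} (hκ : κ ≠ ∞) (hγ0 : 0 < γ) (hγ : γ ≤ 1)
    (h : κ ≤ K + κ * ((1 - γ : ℝ≥0) + γ / 2 : ℝ≥0)) : κ ≤ K / (γ / 2 : ℝ≥0) := by
  have hγ2 : (0 : ℝ≥0) < γ / 2 := by positivity
  rw [ENNReal.le_div_iff_mul_le (.inl (by exact_mod_cast hγ2.ne')) (.inl ENNReal.coe_ne_top)]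
  have e : κ = κ * (γ / 2 : ℝ≥0) + κ * ((1 - γ : ℝ≥0) + γ / 2 : ℝ≥0) := by
    rw [← mul_add, ← ENNReal.coe_add]
    have : γ / 2 + (1 - γ + γ / 2) = 1 := by
      rw [add_left_comm, add_halves, tsub_add_cancel_of_le hγ]
    rw [this, ENNReal.coe_one, mul_one]
  have h2 : κ * (γ / 2 : ℝ≥0) + κ * ((1 - γ : ℝ≥0) + γ / 2 : ℝ≥0) ≤
      K + κ * ((1 - γ : ℝ≥0) + γ / 2 : ℝ≥0) := by rwa [← e]
  exact (ENNReal.add_le_add_iff_right (ENNReal.mul_ne_top hκ ENNReal.coe_ne_top)).1 h2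

/-- If `B` is reached from `C` within time `L` with a probability bounded away from `0`, and the
returns to `C` have a bounded expected cost, then the expected cost until the visit to `B` is
bounded on `C`, relatively to the rate, when the clock starts far from the origin. -/
theorem ReturnBound.lintegral_costUntil_le (hC : IsClosed C) (hB : MeasurableSet B)
    (h : IsSubgeometricRate₀ r) (hf : Measurable f) (hf1 : ∀ x, 1 ≤ f x) {L : ℝ≥0} {K : ℝ≥0∞}
    (hK : M.ReturnBound f r C L K) (hKfin : K ≠ ∞) (t : ℝ≥0) {γ : ℝ≥0} (hγ0 : 0 < γ) (hγ1 : γ ≤ 1)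
    (hγ : ∀ x ∈ C, γ ≤ M.pathLaw x {p | 0 < occupation B t L p}) :
    ∃ s₀ : ℝ≥0, ∃ H ≠ ∞, ∀ s ≥ s₀, ∀ x ∈ C,
      ∫⁻ p, costUntil B t r (fun _ x => f x) s p ∂M.pathLaw x ≤ H * r s := by
  lift K to ℝ≥0 using hKfin
  -- Chosen so that `ε * (1 + K) = γ / 2`, half of the gain `γ`.
  obtain ⟨s₀, hs₀⟩ := h.exists_add_le (ε := γ / 2 / (1 + K)) (by positivity)
  have hγ2 : (0 : ℝ≥0) < γ / 2 := by positivity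
  refine ⟨s₀, K / (γ / 2 : ℝ≥0), ENNReal.div_ne_top ENNReal.coe_ne_top
    (by exact_mod_cast hγ2.ne'), ?_⟩
  have hr0 (s) : (r s : ℝ≥0∞) ≠ 0 := by
    exact_mod_cast (zero_lt_two.trans_le (h.2.2.1 s)).ne'
  -- Truncation in height and in time: the cost becomes bounded, while remaining nonincreasing in
  -- elapsed time as the splitting requires.
  set φ : ℕ → ℝ≥0 → E → ℝ≥0∞ := fun n u x =>
    (Iio (n : ℝ≥0)).indicator (fun _ => min (f x : ℝ≥0∞) n) u with hφdef
  have hφm (n) : Measurable fun q : ℝ≥0 × E => φ n q.1 q.2 :=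
    Measurable.indicator (s := {q : ℝ≥0 × E | q.1 < n})
      ((hf.comp measurable_snd).coe_nnreal_ennreal.min measurable_const)
      (measurableSet_lt measurable_fst measurable_const)
  have hφf (n u x) : φ n u x ≤ f x := (indicator_le_self _ _ _).trans (min_le_left _ _)
  have hφa (n v u x) : φ n (v + u) x ≤ φ n u x := by
    by_cases hu : v + u < n
    · have hu' : u < n := lt_of_le_of_lt le_add_self hu
      simp only [hφdef, indicator_of_mem (show v + u ∈ Iio (n : ℝ≥0) from hu),
        indicator_of_mem (show u ∈ Iio (n : ℝ≥0) from hu'), le_refl]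
    · simp only [hφdef, indicator_of_notMem (show v + u ∉ Iio (n : ℝ≥0) from hu)]
      exact zero_le
  have hφn (n : ℕ) (u : ℝ≥0) (x : E) :
      φ n u x ≤ (Iio (n : ℝ≥0)).indicator (fun _ => (n : ℝ≥0∞)) u :=
    indicator_le_indicator (min_le_right _ _)
  have main (n : ℕ) : ∀ s ≥ s₀, ∀ x ∈ C,
      ∫⁻ p, costUntil B t r (φ n) s p ∂M.pathLaw x ≤ (K / (γ / 2 : ℝ≥0) : ℝ≥0∞) * r s := by
    set κ : ℝ≥0∞ := ⨆ (s) (_ : s ≥ s₀) (x) (_ : x ∈ C),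
      (∫⁻ p, costUntil B t r (φ n) s p ∂M.pathLaw x) / r s with hκ
    have hκle (s) (hs : s ≥ s₀) (x) (hx : x ∈ C) :
        ∫⁻ p, costUntil B t r (φ n) s p ∂M.pathLaw x ≤ κ * r s := by
      rw [← ENNReal.div_le_iff (hr0 s) ENNReal.coe_ne_top]
      exact le_iSup₂_of_le s hs (le_iSup₂_of_le x hx le_rfl)
    have hκfin : κ ≠ ∞ := by
      refine ne_top_of_le_ne_top (b := (r n * n * n : ℝ≥0∞)) ?_ ?_
      · exact ENNReal.mul_ne_top (ENNReal.mul_ne_top ENNReal.coe_ne_top (by simp)) (by simp)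
      · refine iSup₂_le fun s hs => iSup₂_le fun x hx => ?_
        rw [ENNReal.div_le_iff (hr0 s) ENNReal.coe_ne_top]
        calc _ ≤ ∫⁻ p, r s * (r n * n * n) ∂M.pathLaw x :=
              lintegral_mono fun p => costUntil_le_of_bounded h t s (hφn n) p
          _ = _ := by simp [mul_comm]
    have hκK : κ ≤ K + κ * ((1 - γ : ℝ≥0) + γ / 2 : ℝ≥0) := by
      refine iSup₂_le fun s hs => iSup₂_le fun x hx => ?_
      rw [ENNReal.div_le_iff (hr0 s) ENNReal.coe_ne_top]
      obtain ⟨T, hT, hTL, hTle, hTC⟩ := exists_isOptional_eval_mem_ae (M.pathLaw x) hC L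
      have hF : IsPrior T {p | occupation B t L p = 0} :=
        IsPrior.of_past (measurable_past_occupation hB t L (measurableSet_singleton 0)) hT hTL
      have hKx := hK x hx T hT hTle
      have hprob : M.pathLaw x {p | occupation B t L p = 0} ≤ (1 - γ : ℝ≥0) := by
        have h1 : {p : CadlagPath E | occupation B t L p = 0} =
            {p | 0 < occupation B t L p}ᶜ := by ext p; simp
        rw [h1, prob_compl_eq_one_sub (measurableSet_lt measurable_const
          (measurable_occupation hB t measurable_const measurable_id')), ENNReal.coe_sub]
        exact tsub_le_tsub_left (hγ x hx) _
      calc _ ≤ r s * (∫⁻ p, cost f r 0 (T p) p ∂M.pathLaw x) +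
            ∫⁻ p in {p | p ∈ {p | occupation B t L p = 0} ∧ T p ≠ ∞},
              ∫⁻ q, costUntil B t r (φ n) (s + (T p).toNNReal) q
                ∂M.pathLaw (p.1 (T p).toNNReal) ∂M.pathLaw x :=
            StrongMarkovFamily.lintegral_costUntil_le hB t h hf (hφm n) (hφf n) (hφa n) s hT hTL x
        _ ≤ r s * K + ∫⁻ p in {p | p ∈ {p | occupation B t L p = 0} ∧ T p ≠ ∞},
              κ * r (s + (T p).toNNReal) ∂M.pathLaw x := by
            refine add_le_add (mul_le_mul' le_rfl hKx) (lintegral_mono_ae ?_)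
            filter_upwards [ae_restrict_of_ae hTC, ae_restrict_mem hF.measurableSet]
              with p hp1 hp2
            exact hκle _ (hs.le.trans le_self_add) _ (hp1 hp2.2)
        _ ≤ r s * K + κ * (r s * ((1 - γ : ℝ≥0) + (γ / 2 / (1 + K) : ℝ≥0) * (1 + K))) := by
            rw [lintegral_const_mul' _ _ hκfin]
            gcongr
            exact (lintegral_rate_add_le h hf hf1 (hs₀ s hs) x hT hF).trans (by gcongr)
        _ = (K + κ * ((1 - γ : ℝ≥0) + γ / 2 : ℝ≥0)) * r s := by
            have e : ((γ / 2 / (1 + K) : ℝ≥0) : ℝ≥0∞) * (1 + K) = (γ / 2 : ℝ≥0) := by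
              rw [← ENNReal.coe_one, ← ENNReal.coe_add, ← ENNReal.coe_mul,
                div_mul_cancel₀ _ (by positivity)]
            rw [e]
            push_cast
            ring
    intro s hs x hx
    exact (hκle s hs x hx).trans (by gcongr; exact le_div_of_le_add_mul hκfin hγ0 hγ1 hκK)
  intro s hs x hx
  have hφmono (u x) : Monotone fun n => φ n u x := by
    intro n m hnm
    have hnm' : (n : ℝ≥0) ≤ m := by exact_mod_cast hnm
    by_cases hu : u < n
    · simp only [hφdef, indicator_of_mem (show u ∈ Iio (n : ℝ≥0) from hu),
        indicator_of_mem (show u ∈ Iio (m : ℝ≥0) from hu.trans_le hnm')]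
      gcongr
    · simp only [hφdef, indicator_of_notMem (show u ∉ Iio (n : ℝ≥0) from hu)]
      exact zero_le
  have hφsup (u x) : ⨆ n, φ n u x = f x := by
    refine le_antisymm (iSup_le fun n => hφf n u x) ?_
    obtain ⟨n, hn⟩ := exists_nat_gt (max u (f x))
    refine le_iSup_of_le n ?_
    have h1 : f x ≤ (n : ℝ≥0) := (le_max_right _ _).trans hn.le
    simp only [hφdef, indicator_of_mem (show u ∈ Iio (n : ℝ≥0) from
      (le_max_left _ _).trans_lt hn)]
    exact le_min le_rfl (by exact_mod_cast h1)
  have hcmono (p) : Monotone fun n => costUntil B t r (φ n) s p := fun n m hnm =>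
    lintegral_mono fun u => indicator_le_indicator (by gcongr; exact hφmono u _ hnm)
  have hsup (p : CadlagPath E) : costUntil B t r (fun _ x => f x) s p =
      ⨆ n, costUntil B t r (φ n) s p := by
    unfold costUntil
    rw [← lintegral_iSup (fun n => (measurable_costUntil_integrand h.1 (hφm n) s p).indicator
      (measurableSet_occupation_eq_zero hB t p))
      fun n m hnm u => indicator_le_indicator (by gcongr; exact hφmono u _ hnm)]
    refine lintegral_congr fun u => ?_
    by_cases hu : occupation B t u p = 0
    · simp only [indicator_of_mem (show u ∈ {u | occupation B t u p = 0} from hu)]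
      rw [← ENNReal.mul_iSup, hφsup]
    · simp only [indicator_of_notMem (show u ∉ {u | occupation B t u p = 0} from hu), iSup_const]
  simp only [hsup]
  rw [lintegral_iSup (fun n => measurable_costUntil hB t h.1 (hφm n) measurable_const
    measurable_id') fun n m hnm p => hcmono p hnm]
  exact iSup_le fun n => main n s hs x hx

end StrongMarkovFamily

/-! ### From return costs to regular sets -/

namespace StrongMarkovFamily

open CadlagPath

section Comparison

variable {E Ω : Type*} [TopologicalSpace E] [MeasurableSpace E] [MeasurableSpace Ω]
  {M : StrongMarkovFamily E Ω} {f : E → ℝ≥0} {r r' : ℝ≥0 → ℝ≥0} {c : ℝ≥0}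

theorem modulatedMoment_le_mul (h : ∀ t, r t ≤ c * r' t) (C : Set E) (x : E) (δ : ℝ≥0) :
    M.modulatedMoment C x f r δ ≤ c * M.modulatedMoment C x f r' δ := by
  unfold modulatedMoment
  rw [← lintegral_const_mul' _ _ ENNReal.coe_ne_top]
  refine lintegral_mono fun ω => ?_
  rw [← lintegral_const_mul' _ _ ENNReal.coe_ne_top]
  refine lintegral_mono fun s => ?_
  rw [← ENNReal.coe_mul, ENNReal.coe_le_coe, ← mul_assoc]
  gcongr
  exact h s

theorem iSup_modulatedMoment_lt_top (h : ∀ t, r t ≤ c * r' t) (B C : Set E) (δ : ℝ≥0)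
    (hC : ⨆ x ∈ C, M.modulatedMoment B x f r' δ < ⊤) :
    ⨆ x ∈ C, M.modulatedMoment B x f r δ < ⊤ :=
  (iSup₂_le fun x hx => (modulatedMoment_le_mul h B x δ).trans
    (by gcongr; exact le_iSup₂ (f := fun x _ => M.modulatedMoment B x f r' δ) x hx)).trans_lt
    (ENNReal.mul_lt_top ENNReal.coe_lt_top hC)

theorem IsRegular.of_le_mul (h : ∀ t, r t ≤ c * r' t) {C : Set E} (hC : M.IsRegular f r' C) :
    M.IsRegular f r C :=
  ⟨hC.1, fun δ hδ B hB => iSup_modulatedMoment_lt_top h B C δ (hC.2 δ hδ B hB)⟩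

theorem IsRegular.mono {C C' : Set E} (hC : M.IsRegular f r C) (hC' : MeasurableSet C')
    (h : C' ⊆ C) : M.IsRegular f r C' :=
  ⟨hC', fun δ hδ B hB => (biSup_mono h).trans_lt (hC.2 δ hδ B hB)⟩

theorem modulatedMoment_eq (f : E → ℝ≥0) (r : ℝ≥0 → ℝ≥0) (C : Set E) (x : E) (δ : ℝ≥0) :
    M.modulatedMoment C x f r δ =
      ∫⁻ ω, cost f r 0 (hitAfter C (fun _ => δ) (M.path ω)) (M.path ω) ∂M.law x := by
  unfold modulatedMoment cost
  simp only [lt_delayedHittingTime_iff, zero_add, path_apply]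

end Comparison

section Cost

variable {E Ω : Type*} [PseudoMetricSpace E] [MeasurableSpace E] [BorelSpace E]
  [MeasurableSpace Ω] {M : StrongMarkovFamily E Ω} {f : E → ℝ≥0} {r : ℝ≥0 → ℝ≥0} {B C : Set E}

theorem lintegral_cost_le_modulatedMoment (hf : Measurable f) (hr : Measurable r)
    {T : CadlagPath E → ℝ≥0∞} (hT : Measurable T) {δ : ℝ≥0}
    (hle : ∀ p, T p ≤ hitAfter C (fun _ => δ) p) (x : E) :
    ∫⁻ p, cost f r 0 (T p) p ∂M.pathLaw x ≤ M.modulatedMoment C x f r δ := by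
  rw [modulatedMoment_eq, pathLaw_apply, lintegral_map
    (measurable_cost hf hr measurable_const hT measurable_id') M.measurable_path]
  exact lintegral_mono fun ω => cost_mono f r 0 (hle _) _

/-- Before the first visit to `B` after `t` no time has been spent there, so waiting for positive
occupation only costs more. -/
theorem modulatedMoment_le_lintegral_costUntil (hB : MeasurableSet B) (hf : Measurable f)
    (hr : Measurable r) (t : ℝ≥0) (x : E) :
    M.modulatedMoment B x f r t ≤ ∫⁻ p, costUntil B t r (fun _ x => f x) 0 p ∂M.pathLaw x := by
  have hφ : Measurable fun q : ℝ≥0 × E => (f q.2 : ℝ≥0∞) :=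
    (hf.comp measurable_snd).coe_nnreal_ennreal
  rw [modulatedMoment_eq, pathLaw_apply, lintegral_map
    (measurable_costUntil hB t hr (φ := fun _ x => f x) hφ measurable_const measurable_id')
    M.measurable_path]
  refine lintegral_mono fun ω => ?_
  unfold cost costUntil
  rw [← lintegral_indicator (measurableSet_coe_lt _)]
  refine lintegral_mono fun u => ?_
  by_cases hu : (u : ℝ≥0∞) < hitAfter B (fun _ => (t : ℝ≥0∞)) (M.path ω)
  · have h0 : occupation B t u (M.path ω) = 0 := by
      have : {v | (M.path ω).1 v ∈ B} ∩ Ico t u = ∅ := by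
        refine eq_empty_of_forall_notMem fun v hv => ?_
        have h1 := hitAfter_le (T := fun _ => (t : ℝ≥0∞)) (ENNReal.coe_le_coe.2 hv.2.1) hv.1
        exact absurd (hu.trans_le h1) (not_lt.2 (ENNReal.coe_le_coe.2 hv.2.2.le))
      rw [occupation, this, measure_empty]
    rw [indicator_of_mem (by exact hu), indicator_of_mem (by exact h0), ENNReal.coe_mul]
  · rw [indicator_of_notMem (by exact hu)]
    exact zero_le

/-- Pay for reaching `C` at `T`, then apply the bound on `C` with the clock at `T`. `D` does not
depend on the starting point, so a bound on the cost of reaching `C` yields regularity. -/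
theorem exists_modulatedMoment_le (hC : IsClosed C) (hpet : M.IsPetite C)
    (h : IsSubgeometricRate₀ r) (hf : Measurable f) (hf1 : ∀ x, 1 ≤ f x) {δ : ℝ≥0} (hδ : 0 < δ)
    {K : ℝ≥0∞} (hK : M.ReturnBound f r C δ K) (hKfin : K ≠ ∞) (hB : M.IsAccessible B)
    (t : ℝ≥0) : ∃ D ≠ ∞, ∀ x, ∀ T : CadlagPath E → ℝ≥0∞, IsOptional T →
      (∀ᵐ p ∂M.pathLaw x, T p ≠ ∞ → p.1 (T p).toNNReal ∈ C) →
      M.modulatedMoment B x f r t ≤ D * (1 + ∫⁻ p, cost f r 0 (T p) p ∂M.pathLaw x) := by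
  have hBm := hB.1
  obtain ⟨L, γ, hγ0, hγ⟩ := hpet.exists_occupation hBm hB.resolvent_ne_zero t
  obtain ⟨L', hL', K', hK'fin, hK'⟩ := hK.exists_ge hC h hf hf1 hδ hKfin L
  have hγ1 : min γ 1 ≠ ∞ := ne_top_of_le_ne_top ENNReal.one_ne_top (min_le_right _ _)
  have hγc : ((min γ 1).toNNReal : ℝ≥0∞) = min γ 1 := ENNReal.coe_toNNReal hγ1
  obtain ⟨s₁, H, hH, hs₁⟩ := hK'.lintegral_costUntil_le hC hBm h hf hf1 hK'fin t
    (γ := (min γ 1).toNNReal)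
    (by rw [← ENNReal.coe_pos, hγc]; exact lt_min hγ0 one_pos)
    (by rw [← ENNReal.coe_le_coe, hγc]; exact min_le_right _ _)
    (fun x hx => by
      rw [hγc]
      refine (min_le_left _ _).trans ((hγ x hx).trans (measure_mono fun p hp => ?_))
      exact lt_of_lt_of_le hp (occupation_mono B le_rfl hL' p))
  obtain ⟨s₂, hs₂⟩ := h.exists_add_le (ε := 1) one_pos
  -- `s₁` is required by the bound on `C` and `s₂` by the growth inequality; advancing the clock by
  -- `s` is harmless since `r` is nondecreasing.
  set s := max s₁ s₂ with hs
  have hφ : Measurable fun q : ℝ≥0 × E => (f q.2 : ℝ≥0∞) :=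
    (hf.comp measurable_snd).coe_nnreal_ennreal
  refine ⟨r 0 + 2 * (H * r s), ?_, fun x T hT hTC => ?_⟩
  · exact ENNReal.add_ne_top.2 ⟨ENNReal.coe_ne_top, ENNReal.mul_ne_top (by simp)
      (ENNReal.mul_ne_top hH ENNReal.coe_ne_top)⟩
  set G := ∫⁻ p, cost f r 0 (T p) p ∂M.pathLaw x with hG
  -- With horizon 0 the occupation window is empty and the event is everything: no occupation
  -- probability is needed here.
  have hF : IsPrior T {p | occupation B t 0 p = 0} :=
    IsPrior.of_past (measurable_past_occupation hBm t 0 (measurableSet_singleton 0)) hT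
      fun p => zero_le
  calc _ ≤ ∫⁻ p, costUntil B t r (fun _ x => f x) 0 p ∂M.pathLaw x :=
        modulatedMoment_le_lintegral_costUntil hBm hf h.1 t x
    _ ≤ r 0 * G + ∫⁻ p in {p | p ∈ {p | occupation B t 0 p = 0} ∧ T p ≠ ∞},
          ∫⁻ q, costUntil B t r (fun _ x => f x) (0 + (T p).toNNReal) q
            ∂M.pathLaw (p.1 (T p).toNNReal) ∂M.pathLaw x :=
        StrongMarkovFamily.lintegral_costUntil_le hBm t h hf hφ (fun _ _ => le_rfl)
          (fun _ _ _ => le_rfl) 0 hT (fun p => zero_le) x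
    _ ≤ r 0 * G + ∫⁻ p in {p | p ∈ {p | occupation B t 0 p = 0} ∧ T p ≠ ∞},
          H * r (s + (T p).toNNReal) ∂M.pathLaw x := by
        refine add_le_add le_rfl (lintegral_mono_ae ?_)
        filter_upwards [ae_restrict_of_ae hTC, ae_restrict_mem hF.measurableSet] with p hp1 hp2
        refine le_trans (lintegral_mono fun q => ?_) (hs₁ (s + (T p).toNNReal)
          ((le_max_left _ _).trans le_self_add) _ (hp1 hp2.2))
        refine lintegral_mono fun u => indicator_le_indicator ?_
        gcongr
        refine h.2.1 ?_
        gcongr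
        exact zero_le
    _ ≤ r 0 * G + H * (r s * (1 + 1 * (1 + G))) := by
        rw [lintegral_const_mul' _ _ hH]
        gcongr
        refine (lintegral_rate_add_le h hf hf1 (ε := 1) (hs₂ s (le_max_right _ _)) x hT
          hF).trans ?_
        gcongr
        · exact prob_le_one
        · simp
    _ ≤ r 0 * G + H * (r s * (1 + 1 * (1 + G))) + (r 0 + H * r s * G) := le_self_add
    _ = _ := by ring

/-- The states from which the returns to `C` have a finite expected cost form a full set. -/
theorem exists_isFull_iUnion_isRegular (hM : M.IsIrreducible) (hC : IsClosed C) (hne : C.Nonempty)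
    (hpet : M.IsPetite C) (h : IsSubgeometricRate₀ r) (hf : Measurable f) (hf1 : ∀ x, 1 ≤ f x)
    {δ : ℝ≥0} (hδ : 0 < δ) (hfin : ⨆ x ∈ C, M.modulatedMoment C x f r δ < ⊤) :
    ∃ S : Set E, M.IsFull S ∧ ∃ D : ℕ → Set E, (∀ n, M.IsRegular f r (D n)) ∧ S = ⋃ n, D n := by
  obtain ⟨ψ, hψ⟩ := hM.exists_maximal
  obtain ⟨x₀, hx₀⟩ := hne
  have hK : M.ReturnBound f r C δ (⨆ x ∈ C, M.modulatedMoment C x f r δ) :=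
    fun x hx T hT hle => (lintegral_cost_le_modulatedMoment hf h.1 hT.measurable hle x).trans
      (le_iSup₂ (f := fun x _ => M.modulatedMoment C x f r δ) x hx)
  -- A single `T` is built for the path law mixed over the resolvent from `x₀`; it lands in `C` from
  -- resolvent-almost every starting point, and `N` collects the exceptions.
  obtain ⟨T, hT, hTδ, hTle, hTC⟩ := exists_isOptional_eval_mem_ae
    ((M.resolvent x₀).bind M.pathLaw) hC δ
  have hTC' := Measure.ae_ae_of_ae_comp hTC
  set N := toMeasurable (M.resolvent x₀)
    {y | ∀ᵐ p ∂M.pathLaw y, T p ≠ ∞ → p.1 (T p).toNNReal ∈ C}ᶜ with hN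
  have hN0 : M.resolvent x₀ N = 0 := by rw [hN, measure_toMeasurable]; exact hTC'
  have hNm : MeasurableSet N := measurableSet_toMeasurable _ _
  have hNC (y) (hy : y ∉ N) : ∀ᵐ p ∂M.pathLaw y, T p ≠ ∞ → p.1 (T p).toNNReal ∈ C := by
    by_contra hcon
    exact hy (subset_toMeasurable _ _ hcon)
  set g : E → ℝ≥0∞ := fun y => ∫⁻ p, cost f r 0 (T p) p ∂M.pathLaw y with hg
  have hcm : Measurable fun p : CadlagPath E => cost f r 0 (T p) p :=
    measurable_cost hf h.1 measurable_const hT.measurable measurable_id'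
  have hgm : Measurable g := hcm.lintegral_kernel
  have hDm (n : ℕ) : MeasurableSet (Nᶜ ∩ {y | g y ≤ n}) :=
    hNm.compl.inter (measurableSet_le hgm measurable_const)
  -- The cost of reaching `C` from the state at time `u` is part of the cost of a return delayed by
  -- at least `u + δ`, which is finite from `x₀ ∈ C`.
  have hgfin (u : ℝ≥0) : ∫⁻ p, g (p.1 u) ∂M.pathLaw x₀ ≠ ∞ := by
    obtain ⟨L, hL, K, hKfin, hKL⟩ := hK.exists_ge hC h hf hf1 hδ hfin.ne (u + δ)
    obtain ⟨R, hR, hRL, hRle, hRC⟩ := exists_isOptional_eval_mem_ae (M.pathLaw x₀) hC L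
    refine ne_top_of_le_ne_top hKfin (le_trans ?_ (hKL x₀ hx₀ R hR hRle))
    rw [← M.lintegral_shift_const x₀ u hcm]
    refine lintegral_mono_ae ?_
    filter_upwards [hRC] with p hp
    calc cost f r 0 (T (shift u p)) (shift u p) ≤ cost f r u (T (shift u p)) (shift u p) := by
          refine lintegral_mono fun v => ENNReal.coe_le_coe.2 ?_
          gcongr
          exact h.2.1 (by gcongr; exact zero_le)
      _ ≤ cost f r 0 (u + T (shift u p)) p := by
          rw [cost_add hf h.1]
          exact le_add_self
      _ ≤ cost f r 0 (R p) p := by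
          refine cost_mono f r 0 ?_ p
          by_cases hRp : R p = ∞
          · rw [hRp]; exact le_top
          have h1 : u + δ ≤ (R p).toNNReal := by
            rw [← ENNReal.coe_le_coe, ENNReal.coe_toNNReal hRp]
            exact (ENNReal.coe_le_coe.2 hL).trans (hRL p)
          have h2 : u ≤ (R p).toNNReal := le_self_add.trans h1
          have h3 : T (shift u p) ≤ ((R p).toNNReal - u : ℝ≥0) := by
            refine (hTle _).trans
              (hitAfter_le (ENNReal.coe_le_coe.2 (le_tsub_of_add_le_left h1)) ?_)
            rw [shift_apply, add_tsub_cancel_of_le h2]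
            exact hp hRp
          calc u + T (shift u p) ≤ u + ((R p).toNNReal - u : ℝ≥0) := by gcongr
            _ = R p := by
              rw [← ENNReal.coe_add, add_tsub_cancel_of_le h2, ENNReal.coe_toNNReal hRp]
  have hginf : M.resolvent x₀ {y | g y = ∞} = 0 := by
    have hm : MeasurableSet {y | g y = ∞} := hgm (measurableSet_singleton ∞)
    rw [resolvent, sampled_apply _ _ hm]
    refine lintegral_eq_zero_of_ae_eq_zero (.of_forall fun u => ?_)
    change M.trans u x₀ {y | g y = ∞} = 0
    rw [← M.pathLaw_eval u x₀ hm]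
    have h1 := ae_lt_top (hgm.comp (measurable_eval u)) (hgfin u)
    refine measure_eq_zero_iff_ae_notMem.2 ?_
    filter_upwards [h1] with p hp
    exact hp.ne
  refine ⟨⋃ n : ℕ, Nᶜ ∩ {y | g y ≤ n}, ⟨.iUnion hDm, ψ, hψ, ?_⟩, _, fun n => ⟨hDm n, ?_⟩, rfl⟩
  · refine (isIrreducibilityMeasure_iff.1 hψ.1).2.2 x₀
      (measure_mono_null (fun y hy => ?_) (measure_union_null hN0 hginf))
    by_contra hcon
    simp only [mem_union, not_or, mem_ofPred_eq] at hcon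
    obtain ⟨n, hn⟩ := ENNReal.exists_nat_gt hcon.2
    exact hy (mem_iUnion.2 ⟨n, hcon.1, hn.le⟩)
  · intro t _ B hB
    obtain ⟨D, hD, hle⟩ := exists_modulatedMoment_le hC hpet h hf hf1 hδ hK hfin.ne hB t
    refine lt_of_le_of_lt (b := D * (1 + n)) (iSup₂_le fun y hy => ?_)
      (ENNReal.mul_lt_top hD.lt_top (by simp [ENNReal.add_lt_top]))
    refine (hle y T hT (hNC y hy.1)).trans ?_
    gcongr
    exact hy.2

end Cost

end StrongMarkovFamily

/-! ### The equivalence -/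

theorem mainTheorem6 {E Ω : Type*} [MetricSpace E] [LocallyCompactSpace E]
    [TopologicalSpace.SeparableSpace E] [MeasurableSpace E] [BorelSpace E] [MeasurableSpace Ω]
    (M : StrongMarkovFamily E Ω) (hM : M.IsIrreducible)
    (f : E → ℝ≥0) (hf : Measurable f) (hf1 : ∀ x, 1 ≤ f x)
    (r : ℝ≥0 → ℝ≥0) (hr : IsSubgeometricRate r)
    (hr_loc : ∀ T : ℝ≥0, ∃ c K : ℝ≥0, 0 < c ∧ ∀ t ≤ T, c ≤ r t ∧ r t ≤ K) :
    [∃ C : Set E, C.Nonempty ∧ IsClosed C ∧ M.IsPetite C ∧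
        ∃ δ : ℝ≥0, 0 < δ ∧ ⨆ x ∈ C, M.modulatedMoment C x f r δ < ⊤,
      ∃ C : Set E, IsClosed C ∧ M.IsAccessible C ∧ M.IsRegular f r C,
      ∃ S : Set E, M.IsFull S ∧
        ∃ C : ℕ → Set E, (∀ n, M.IsRegular f r (C n)) ∧ S = ⋃ n, C n].TFAE := by
  have : SecondCountableTopology E := UniformSpace.secondCountable_of_separable E
  tfae_have 1 → 3 := by
    rintro ⟨C, hne, hC, hpet, δ, hδ, hfin⟩
    obtain ⟨r₀, h₀, c, hc, hc'⟩ := hr.exists_le_le hr_loc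
    obtain ⟨S, hS, D, hD, hSD⟩ :=
      StrongMarkovFamily.exists_isFull_iUnion_isRegular hM hC hne hpet h₀ hf hf1 hδ
      (StrongMarkovFamily.iSup_modulatedMoment_lt_top hc C C δ hfin)
    exact ⟨S, hS, D, fun n => (hD n).of_le_mul hc', hSD⟩
  tfae_have 3 → 2 := by
    rintro ⟨S, ⟨-, ψ, hψ, hψS⟩, C, hC, rfl⟩
    have := hψ.1.1
    obtain ⟨n, hn⟩ : ∃ n, ψ (C n) ≠ 0 := by
      by_contra! h
      refine hψ.1.2.1 (Measure.measure_univ_eq_zero.1 ?_)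
      rw [← union_compl_self (⋃ n, C n)]
      exact measure_union_null (measure_iUnion_null h) hψS
    obtain ⟨F, hFC, hF, hFpos⟩ :=
      exists_isClosed_subset_measure_pos ψ (hC n).1 (pos_iff_ne_zero.2 hn)
    exact ⟨F, hF, ⟨hF.measurableSet, ψ, hψ, hFpos⟩, (hC n).mono hF.measurableSet hFC⟩
  tfae_have 2 → 1 := by
    rintro ⟨C, -, ⟨hCm, ψ, hψ, hψC⟩, hreg⟩
    -- `F` serves twice: as the set of starting points, by restriction from `C`, and as the
    -- accessible target in the regularity of `C`.
    obtain ⟨F, hFC, hF, hFpos, hpet⟩ := hψ.exists_isPetite hCm hψC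
    refine ⟨F, nonempty_of_measure_ne_zero hFpos.ne', hF, hpet, 1, one_pos, ?_⟩
    exact (hreg.mono hF.measurableSet hFC).2 1 one_pos F ⟨hF.measurableSet, ψ, hψ, hFpos⟩
  tfae_finish
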